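/- Let $d\ge 1$ be an integer, write $B_r=\{x\in\mathbb R^d:|x|\le r\}$ and let $|B_r|$ be its volume. Let $0<\epsilon<d/2$, $0<\eta\le 1/2$, and let $\rho_\eta\ge 0$ be a smooth function on $\mathbb R$ supported in $[1-\eta,1+\eta]$ with $\int\rho_\eta(t)\,dt=1$. Set $$Q_{0,\eta}(x):=\int_{1-\eta}^{1+\eta}\frac{(1_{B_t}*1_{B_t})(x)}{|B_t|}\,\rho_\eta(t)\,dt ,\qquad x\in\mathbb R^d .$$ Call a real function $K$, defined almost everywhere on $\mathbb R^d$, positive definite if it is locally integrable and $\iint K(x-y)\varphi(x)\overline{\varphi(y)}\,dx\,dy\ge 0$ for all $\varphi\in C_c^\infty(\mathbb R^d;\mathbb C)$. Then there is a constant $C=C(\rho_\eta,d,\epsilon)>0$, depending only on $\rho_\eta$, $d$ and $\epsilon$, such that the following holds for every $s$ with $\epsilon\le s\le d-\epsilon$, every integer $M\ge 1$, and all real numbers $0<R_1<\dots<R_M$ with $R_{k+1}>(1+4\sqrt d\,|B_1|)R_k$ for $1\le k<M$. With $Q_{i,\eta}(x):=Q_{0,\eta}(x/R_i)$, the kernels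 $$\frac{C}{M}|x|^{-s}\pm\frac1M\sum_{i=1}^M\left(\frac{1-Q_{i,\eta}(x)}{|x|^s}-\left(\int_{\mathbb R^d}Q_{i,\eta}(y)\,dy\right)^{-1}\int_{\mathbb R^d}\frac{Q_{i,\eta}(y)}{|x-y|^s}\,dy\right)$$ (for both choices of the sign) and $$\frac1M\sum_{i=1}^M\left[\left(\int_{\mathbb R^d}Q_{i,\eta}(y)\,dy\right)^{-1}\int_{\mathbb R^d}\frac{Q_{i,\eta}(y)}{|x-y|^s}\,dy\right],$$ as well as $$\frac{C}{|x|^s}\pm\frac{Q_{i,\eta}(x)}{|x|^s}\qquad\text{for every }1\le i\le M\text{ and both choices of the sign},$$ are positive definite. -/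

import Mathlib

open MeasureTheory Set
open scoped ContDiff ComplexConjugate ComplexOrder Convolution

noncomputable section

namespace FeffermanGregg

/-- `ℝ^d` with its Euclidean norm. -/
abbrev E (d : ℕ) : Type := EuclideanSpace ℝ (Fin d)

/-- The closed ball `B_r` of radius `r` centred at the origin of `ℝ^d`. -/
def B (d : ℕ) (r : ℝ) : Set (E d) := Metric.closedBall 0 r

/-- The volume `|B_r|`. -/
def volB (d : ℕ) (r : ℝ) : ℝ := volume.real (B d r)

/-- The indicator function `1_{B_r}`. -/
def indB (d : ℕ) (r : ℝ) : E d → ℝ := (B d r).indicator 1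

/-- The self-convolution `1_{B_r} * 1_{B_r}`. -/
def ballConv (d : ℕ) (r : ℝ) : E d → ℝ :=
  indB d r ⋆[ContinuousLinearMap.mul ℝ ℝ, volume] indB d r

/-- An admissible averaging profile: a nonnegative function in `C_0^∞([1-η,1+η])` of integral one. -/
structure IsProfile (η : ℝ) (ρ : ℝ → ℝ) : Prop where
  smooth : ContDiff ℝ ∞ ρ
  support_subset : tsupport ρ ⊆ Icc (1 - η) (1 + η)
  nonneg : ∀ t, 0 ≤ ρ t
  integral_eq_one : ∫ t, ρ t = 1

/-- The mollified ball self-convolution at unit scale,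
`Q_{0,η}(x) = ∫_{1-η}^{1+η} (1_{B_t} * 1_{B_t})(x) / |B_t| ρ(t) dt`. -/
def Q₀ (d : ℕ) (η : ℝ) (ρ : ℝ → ℝ) (x : E d) : ℝ :=
  ∫ t in (1 - η)..(1 + η), ballConv d t x / volB d t * ρ t

/-- The mollified ball self-convolution at scale `R`, `Q_R(x) = Q_{0,η}(x / R)`. -/
def Q (d : ℕ) (η : ℝ) (ρ : ℝ → ℝ) (R : ℝ) (x : E d) : ℝ := Q₀ d η ρ (R⁻¹ • x)

/-- The average `(∫ Q_R)⁻¹ ∫ Q_R(y) |x - y|^{-s} dy`. -/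
def avgRiesz (d : ℕ) (η : ℝ) (ρ : ℝ → ℝ) (s R : ℝ) (x : E d) : ℝ :=
  (∫ y, Q d η ρ R y)⁻¹ * ∫ y, Q d η ρ R y / ‖x - y‖ ^ s

/-- The error term `(1 - Q_R(x)) / |x|^s - (∫ Q_R)⁻¹ ∫ Q_R(y) |x - y|^{-s} dy`. -/
def errRiesz (d : ℕ) (η : ℝ) (ρ : ℝ → ℝ) (s R : ℝ) (x : E d) : ℝ :=
  (1 - Q d η ρ R x) / ‖x‖ ^ s - avgRiesz d η ρ s R x

/-- Scales `0 < R_1 < ⋯ < R_M` with `R_{k+1} > (1 + 4 √d |B_1|) R_k`. -/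
structure IsScales (d M : ℕ) (R : ℕ → ℝ) : Prop where
  pos : 0 < R 1
  growth : ∀ k, 1 ≤ k → k < M → (1 + 4 * √(d : ℝ) * volB d 1) * R k < R (k + 1)

/-- Positive definiteness of a translation-invariant kernel `K(x - y)` on `ℝ^d`, where `K` may be
singular (or undefined) at the origin: `K` is locally integrable and
`∬ K(x - y) φ(x) conj(φ(y)) dx dy` is real and nonnegative for all `φ ∈ C_c^∞(ℝ^d; ℂ)`. -/
def IsPositiveDefinite {d : ℕ} (K : E d → ℝ) : Prop :=
  LocallyIntegrable K volume ∧
    ∀ φ : E d → ℂ, ContDiff ℝ ∞ φ → HasCompactSupport φ →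
      0 ≤ ∫ x, ∫ y, (K (x - y) : ℂ) * φ x * conj (φ y)

end FeffermanGregg

end

/-! All kernels are treated as Fourier multipliers. On a test function `φ` the quadratic form of `K`
is `∫ K · autocorr φ`, and the autocorrelation has Fourier transform `‖𝓕 φ‖ ^ 2`; so `K` is positive
definite once it acts as multiplication by a symbol that is nonnegative almost everywhere
(`HasSymbol.isPositiveDefinite`).

Put `a = d - s` and write `m` for the Fourier transform of `Q₀`. The Riesz kernel has symbol `c ‖k‖
^ (-a)` with `c > 0`. Multiplication by `Q_R` convolves this symbol with a dilate of `m`, and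
averaging against `Q_R` multiplies it by `m(-Rk) / ∫ Q₀`. By homogeneity the error kernel has symbol
`c ‖k‖ ^ (-a)` times `errRatio(-Rk)`, where `errRatio(k) = 1 - ‖k‖ ^ a (‖·‖ ^ (-a) * m)(k) - m(k) /
∫ Q₀`. Since `m` is an average of squares it is nonnegative, which settles the averaged kernel and
the plus sign in the last pair.

The heart is `exists_multiplier_bound`: `|errRatio k|` is at most a constant times the smaller of
`‖k‖ ^ e` and `‖k‖ ^ (-e)` for some `e > 0`, uniformly in `a`. At low frequency the potential term
carries the factor `‖k‖ ^ a`, and `1 - m / ∫ Q₀` vanishes linearly at `0`. At high frequency `m` is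
small and the potential looks like that of a unit mass at the origin, because `∫ m = Q₀(0) = 1`. As
the scales grow geometrically, the sum of these bounds over all scales is bounded independently of
`M` (`sum_min_inv_le`), so a fixed multiple of the Riesz symbol dominates it.

The high-frequency estimate needs `m(k) = O(‖k‖ ^ (-(d + 1)))`. No Bessel asymptotics enter. The
ball overlap function is Lipschitz, so testing it against a difference of two Gaussians bounds its
spectral mass in an annulus of radius `r` by `O(1 / r)` (`exists_annulus_bound`). By radial
symmetry, averaging over the radius `t` turns this into a pointwise bound on `m`. -/

noncomputable section

namespace FeffermanGregg

open scoped FourierTransform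
open Real (Gamma)

/-! ### Riesz kernels under the Fourier transform -/

section

/-- The integral of `‖z‖ ^ (-s)` over the unit ball. -/
def ballRiesz (d : ℕ) (s : ℝ) : ℝ := ∫ z in Metric.ball (0 : E d) 1, ‖z‖ ^ (-s)

lemma integrableOn_ball_riesz {d : ℕ} (hd : 1 ≤ d) {s : ℝ} (hsd : s < d) (r : ℝ) :
    IntegrableOn (fun z : E d => ‖z‖ ^ (-s)) (Metric.ball 0 r) := by
  refine integrableOn_ball_of_norm_le_rpow (by simpa using hd) (C := 1) (α := s)
    (by simpa using hsd) ?_ ?_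
  · refine Filter.Eventually.of_forall fun x => ?_
    rw [one_mul, Real.norm_of_nonneg (by positivity)]
  · exact (by fun_prop : Measurable fun z : E d => ‖z‖ ^ (-s)).aestronglyMeasurable

lemma locallyIntegrable_riesz {d : ℕ} (hd : 1 ≤ d) {s : ℝ} (hsd : s < d) :
    LocallyIntegrable (fun z : E d => ‖z‖ ^ (-s)) := by
  refine locallyIntegrable_of_norm_le_rpow (by simpa using hd) (C := 1) (α := s)
    (by simpa using hsd) ?_ ?_
  · refine Filter.Eventually.of_forall fun x => ?_
    rw [one_mul, Real.norm_of_nonneg (by positivity)]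
  · exact (by fun_prop : Measurable fun z : E d => ‖z‖ ^ (-s)).aestronglyMeasurable

lemma ballRiesz_nonneg (d : ℕ) (s : ℝ) : 0 ≤ ballRiesz d s :=
  integral_nonneg fun _ => by positivity

/-- Within distance one of the singularity `f` is replaced by its supremum; farther away the weight
is at most one. The integral of the majorant does not depend on `y`, which is the source of all
bounds uniform in the position of the singularity. -/
lemma riesz_mul_le {d : ℕ} {s : ℝ} (hs : 0 ≤ s) {f : E d → ℝ} {b : ℝ}
    (hf0 : ∀ z, 0 ≤ f z) (hfb : ∀ z, f z ≤ b) (y z : E d) :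
    ‖z - y‖ ^ (-s) * f z
      ≤ b * (Metric.ball (0 : E d) 1).indicator (fun z => ‖z‖ ^ (-s)) (z - y) + f z := by
  have hb : 0 ≤ b := (hf0 0).trans (hfb 0)
  by_cases h : z - y ∈ Metric.ball (0 : E d) 1
  · rw [indicator_of_mem h]
    nlinarith [hf0 z, hfb z, Real.rpow_nonneg (norm_nonneg (z - y)) (-s)]
  · rw [indicator_of_notMem h]
    have h1 : 1 ≤ ‖z - y‖ := by simpa using h
    have := Real.rpow_le_one_of_one_le_of_nonpos h1 (neg_nonpos.2 hs)
    nlinarith [hf0 z]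

lemma integrable_riesz_majorant {d : ℕ} (hd : 1 ≤ d) {s : ℝ} (hsd : s < d) {f : E d → ℝ}
    (hf : Integrable f) (b : ℝ) (y : E d) :
    Integrable fun z =>
      b * (Metric.ball (0 : E d) 1).indicator (fun z => ‖z‖ ^ (-s)) (z - y) + f z :=
  (((integrable_indicator_iff measurableSet_ball).2
    (integrableOn_ball_riesz hd hsd 1)).comp_sub_right y |>.const_mul b).add hf

lemma integrable_riesz_mul {d : ℕ} (hd : 1 ≤ d) {s : ℝ} (hs : 0 ≤ s) (hsd : s < d)
    {f : E d → ℝ} (hf : Integrable f) {b : ℝ} (hf0 : ∀ z, 0 ≤ f z) (hfb : ∀ z, f z ≤ b)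
    (y : E d) : Integrable fun z => ‖z - y‖ ^ (-s) * f z := by
  refine (integrable_riesz_majorant hd hsd hf b y).mono' ?_ (Filter.Eventually.of_forall fun z => ?_)
  · exact (by fun_prop : Measurable fun z : E d => ‖z - y‖ ^ (-s)).aestronglyMeasurable.mul
      hf.aestronglyMeasurable
  · rw [Real.norm_of_nonneg (mul_nonneg (by positivity) (hf0 z))]
    exact riesz_mul_le hs hf0 hfb y z

lemma integral_riesz_mul_le {d : ℕ} (hd : 1 ≤ d) {s : ℝ} (hs : 0 ≤ s) (hsd : s < d)
    {f : E d → ℝ} (hf : Integrable f) {b : ℝ} (hf0 : ∀ z, 0 ≤ f z) (hfb : ∀ z, f z ≤ b)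
    (y : E d) : ∫ z, ‖z - y‖ ^ (-s) * f z ≤ b * ballRiesz d s + ∫ z, f z := by
  have hi := (integrable_indicator_iff (μ := volume) measurableSet_ball).2
    (integrableOn_ball_riesz hd hsd 1)
  refine (integral_mono (integrable_riesz_mul hd hs hsd hf hf0 hfb y)
    (integrable_riesz_majorant hd hsd hf b y) (riesz_mul_le hs hf0 hfb y)).trans_eq ?_
  rw [integral_add ((hi.comp_sub_right y).const_mul b) hf, integral_const_mul,
    integral_sub_right_eq_self
      (fun z => (Metric.ball (0 : E d) 1).indicator (fun z => ‖z‖ ^ (-s)) z) y,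
    integral_indicator measurableSet_ball, ballRiesz]

lemma integrable_riesz_mul_complex {d : ℕ} (hd : 1 ≤ d) {s : ℝ} (hs : 0 ≤ s) (hsd : s < d)
    {f : E d → ℂ} (hf : Integrable f) {b : ℝ} (hfb : ∀ z, ‖f z‖ ≤ b) (y : E d) :
    Integrable fun z => ((‖z - y‖ ^ (-s) : ℝ) : ℂ) * f z := by
  refine (integrable_riesz_mul hd hs hsd hf.norm (fun _ => norm_nonneg _) hfb y).mono' ?_
    (Filter.Eventually.of_forall fun z => ?_)
  · exact (by fun_prop :
      Measurable fun z : E d => ((‖z - y‖ ^ (-s) : ℝ) : ℂ)).aestronglyMeasurable.mul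
      hf.aestronglyMeasurable
  · rw [norm_mul, Complex.norm_real, Real.norm_of_nonneg (by positivity)]

lemma norm_fourier_le {d : ℕ} (f : E d → ℂ) (k : E d) : ‖𝓕 f k‖ ≤ ∫ z, ‖f z‖ :=
  VectorFourier.norm_fourierIntegral_le_integral_norm _ _ _ _ _

lemma norm_le_integral_fourier {d : ℕ} {f : E d → ℂ} (hc : Continuous f) (hf : Integrable f)
    (hf' : Integrable (𝓕 f)) (z : E d) : ‖f z‖ ≤ ∫ k, ‖𝓕 f k‖ := by
  rw [← congrFun (hc.fourierInv_fourier_eq hf hf') z]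
  exact VectorFourier.norm_fourierIntegral_le_integral_norm _ _ _ _ _

lemma continuous_fourier {d : ℕ} {f : E d → ℂ} (hf : Integrable f) : Continuous (𝓕 f) :=
  VectorFourier.fourierIntegral_continuous Real.continuous_fourierChar
    (by simpa using continuous_inner) hf

/-- The multiplication formula against a Gaussian, whose transform is again a Gaussian. It serves
both the Riesz transform formula and the annulus estimate. -/
lemma integral_gaussian_mul_eq {d : ℕ} {A : E d → ℂ} (hA : Integrable A)
    {t : ℝ} (ht : 0 < t) :
    ∫ z, (Real.exp (-(Real.pi * t * ‖z‖ ^ 2)) : ℂ) * A z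
      = ((t ^ (-(d : ℝ) / 2) : ℝ) : ℂ) *
        ∫ k, (Real.exp (-(Real.pi * t⁻¹ * ‖k‖ ^ 2)) : ℂ) * 𝓕 A k := by
  have hre : 0 < ((Real.pi * t⁻¹ : ℝ) : ℂ).re := by
    rw [Complex.ofReal_re]; positivity
  set g : E d → ℂ := fun v => Complex.exp (-((Real.pi * t⁻¹ : ℝ) : ℂ) * ‖v‖ ^ 2) with hg
  have hgi : Integrable g := by
    simpa [hg] using GaussianFourier.integrable_cexp_neg_mul_sq_norm_add hre 0 (0 : E d)
  have hF : ∀ w, 𝓕 g w = ((t ^ ((d : ℝ) / 2) : ℝ) : ℂ) *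
      (Real.exp (-(Real.pi * t * ‖w‖ ^ 2)) : ℂ) := by
    intro w
    rw [hg, fourier_gaussian_innerProductSpace hre]
    have hpi : (Real.pi : ℂ) ≠ 0 := by exact_mod_cast Real.pi_ne_zero
    have ht' : (t : ℂ) ≠ 0 := by exact_mod_cast ht.ne'
    congr 1
    · rw [Complex.ofReal_cpow ht.le]
      congr 1
      · push_cast; field_simp
      · simp
    · rw [Complex.ofReal_exp]
      congr 1
      push_cast; field_simp
  have key : ∫ k, 𝓕 A k * g k = ∫ z, A z * 𝓕 g z := by
    have := VectorFourier.integral_fourierIntegral_smul_eq_flip (μ := volume) (ν := volume)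
      (L := innerₗ (E d)) Real.continuous_fourierChar (by simpa using continuous_inner) hA hgi
    rw [flip_innerₗ] at this
    exact this
  simp_rw [hF] at key
  have h1 : ∀ z, A z * (((t ^ ((d : ℝ) / 2) : ℝ) : ℂ) *
      (Real.exp (-(Real.pi * t * ‖z‖ ^ 2)) : ℂ)) = ((t ^ ((d : ℝ) / 2) : ℝ) : ℂ) *
      ((Real.exp (-(Real.pi * t * ‖z‖ ^ 2)) : ℂ) * A z) := fun z => by ring
  simp_rw [h1] at key
  rw [integral_const_mul] at key
  have h2 : ∀ k, (Real.exp (-(Real.pi * t⁻¹ * ‖k‖ ^ 2)) : ℂ) * 𝓕 A k = 𝓕 A k * g k := by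
    intro k
    rw [hg, mul_comm, Complex.ofReal_exp]
    push_cast
    ring_nf
  simp_rw [h2]
  rw [key, ← mul_assoc, ← Complex.ofReal_mul, ← Real.rpow_add ht]
  simp [neg_div]

/-- A Riesz kernel is a Mellin superposition of Gaussians in the parameter `t`, by the Gamma
integral; absolute integrability against `f` permits Fubini. -/
lemma integral_rpow_mul_integral_gaussian {d : ℕ} {s : ℝ} (hs : 0 < s) {f : E d → ℂ}
    (hf : AEStronglyMeasurable f)
    (hf' : Integrable fun z => ((‖z‖ ^ (-s) : ℝ) : ℂ) * f z) (hd : 1 ≤ d) :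
    ∫ t in Ioi (0 : ℝ), ((t ^ (s / 2 - 1) : ℝ) : ℂ) *
        ∫ z, (Real.exp (-(Real.pi * t * ‖z‖ ^ 2)) : ℂ) * f z
      = ((Real.pi ^ (-s / 2) * Gamma (s / 2) : ℝ) : ℂ) * ∫ z, ((‖z‖ ^ (-s) : ℝ) : ℂ) * f z := by
  have : Nonempty (Fin d) := ⟨⟨0, hd⟩⟩
  have hne : ∀ᵐ z : E d, z ≠ 0 := by
    simp [ae_iff]
  have hint : ∀ z : E d, z ≠ 0 → ∫ t in Ioi (0 : ℝ),
      t ^ (s / 2 - 1) * Real.exp (-(Real.pi * t * ‖z‖ ^ 2))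
        = Real.pi ^ (-s / 2) * Gamma (s / 2) * ‖z‖ ^ (-s) := by
    intro z hz
    have hz' : 0 < ‖z‖ := norm_pos_iff.2 hz
    have h := Real.integral_rpow_mul_exp_neg_mul_Ioi (a := s / 2) (r := Real.pi * ‖z‖ ^ 2)
      (by positivity) (by positivity)
    have e : ∀ t : ℝ, Real.pi * ‖z‖ ^ 2 * t = Real.pi * t * ‖z‖ ^ 2 := fun t => by ring
    simp_rw [e] at h
    rw [h, one_div, Real.inv_rpow (by positivity), Real.mul_rpow Real.pi_pos.le (by positivity),
      ← Real.rpow_natCast, ← Real.rpow_mul (norm_nonneg z), neg_div, Real.rpow_neg Real.pi_pos.le,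
      Real.rpow_neg (norm_nonneg z)]
    have : ((2 : ℕ) : ℝ) * (s / 2) = s := by push_cast; ring
    rw [this]
    field_simp
  have hio : ∀ z : E d, z ≠ 0 → IntegrableOn (fun t : ℝ =>
      t ^ (s / 2 - 1) * Real.exp (-(Real.pi * t * ‖z‖ ^ 2))) (Ioi 0) := by
    intro z hz
    -- The integral of a non-integrable function is `0` by convention, whereas the value just
    -- computed is positive.
    by_contra h
    have h1 := hint z hz
    rw [integral_undef h] at h1
    have hz' : 0 < ‖z‖ := norm_pos_iff.2 hz
    have := Real.Gamma_pos_of_pos (half_pos hs)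
    have h2 : 0 < Real.pi ^ (-s / 2) * Gamma (s / 2) * ‖z‖ ^ (-s) := by positivity
    exact h2.ne h1
  have hprod : Integrable (fun p : ℝ × E d => ((p.1 ^ (s / 2 - 1) *
      Real.exp (-(Real.pi * p.1 * ‖p.2‖ ^ 2)) : ℝ) : ℂ) * f p.2)
      ((volume.restrict (Ioi 0)).prod volume) := by
    have hm : AEStronglyMeasurable (fun p : ℝ × E d => ((p.1 ^ (s / 2 - 1) *
        Real.exp (-(Real.pi * p.1 * ‖p.2‖ ^ 2)) : ℝ) : ℂ) * f p.2)
        ((volume.restrict (Ioi 0)).prod volume) := by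
      refine AEStronglyMeasurable.mul (Measurable.aestronglyMeasurable (by fun_prop)) ?_
      exact hf.comp_snd
    rw [integrable_prod_iff' hm]
    refine ⟨?_, ?_⟩
    · filter_upwards [hne] with z hz
      exact (hio z hz).ofReal.mul_const _
    · refine (hf'.norm.const_mul (Real.pi ^ (-s / 2) * Gamma (s / 2))).congr ?_
      filter_upwards [hne] with z hz
      simp_rw [norm_mul, Complex.norm_real]
      rw [integral_mul_const, Real.norm_of_nonneg (Real.rpow_nonneg (norm_nonneg z) _),
        ← mul_assoc, ← hint z hz]
      congr 1
      refine setIntegral_congr_fun measurableSet_Ioi fun t ht => ?_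
      have : (0 : ℝ) < t := ht
      rw [Real.norm_of_nonneg (by positivity)]
  calc _ = ∫ t in Ioi (0 : ℝ), ∫ z, ((t ^ (s / 2 - 1) *
        Real.exp (-(Real.pi * t * ‖z‖ ^ 2)) : ℝ) : ℂ) * f z := by
        refine integral_congr_ae (Filter.Eventually.of_forall fun t => ?_)
        simp only
        rw [← integral_const_mul]
        refine integral_congr_ae (Filter.Eventually.of_forall fun z => ?_)
        simp only
        push_cast
        ring
    _ = ∫ z, ∫ t in Ioi (0 : ℝ), ((t ^ (s / 2 - 1) *
        Real.exp (-(Real.pi * t * ‖z‖ ^ 2)) : ℝ) : ℂ) * f z := integral_integral_swap hprod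
    _ = _ := by
        rw [← integral_const_mul]
        refine integral_congr_ae ?_
        filter_upwards [hne] with z hz
        rw [integral_mul_const, integral_complex_ofReal, hint z hz]
        push_cast
        ring

/-- The positive constant `c` such that the Fourier transform of `‖x‖ ^ (-s)` is
`c ‖k‖ ^ (-(d - s))`. -/
def rieszConst (d : ℕ) (s : ℝ) : ℝ :=
  (Real.pi ^ (-s / 2) * Gamma (s / 2))⁻¹ * (Real.pi ^ (-(d - s) / 2) * Gamma ((d - s) / 2))

lemma rieszConst_pos {d : ℕ} {s : ℝ} (hs : 0 < s) (hsd : s < d) : 0 < rieszConst d s := by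
  have h1 := Real.Gamma_pos_of_pos (half_pos hs)
  have h2 := Real.Gamma_pos_of_pos (half_pos (sub_pos.2 hsd))
  have := Real.pi_pos
  unfold rieszConst
  positivity

/-- The Fourier transform of the Riesz kernel, tested against a function. -/
theorem integral_riesz_mul_eq {d : ℕ} (hd : 1 ≤ d) {s : ℝ} (hs : 0 < s) (hsd : s < d)
    {A : E d → ℂ} (hc : Continuous A) (hA : Integrable A) (hA' : Integrable (𝓕 A)) :
    ∫ z, ((‖z‖ ^ (-s) : ℝ) : ℂ) * A z
      = (rieszConst d s : ℂ) * ∫ k, ((‖k‖ ^ (-(d - s)) : ℝ) : ℂ) * 𝓕 A k := by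
  have hds : 0 < d - s := sub_pos.2 hsd
  have i1 := integrable_riesz_mul_complex hd hs.le hsd hA (norm_le_integral_fourier hc hA hA') 0
  have i2 := integrable_riesz_mul_complex hd hds.le (by linarith) hA' (norm_fourier_le A) 0
  simp only [sub_zero] at i1 i2
  have e1 := integral_rpow_mul_integral_gaussian hs hA.aestronglyMeasurable i1 hd
  have e2 := integral_rpow_mul_integral_gaussian hds hA'.aestronglyMeasurable i2 hd
  have e3 : ∫ t in Ioi (0 : ℝ), ((t ^ (s / 2 - 1) : ℝ) : ℂ) *
        ∫ z, (Real.exp (-(Real.pi * t * ‖z‖ ^ 2)) : ℂ) * A z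
      = ∫ t in Ioi (0 : ℝ), ((t ^ ((d - s) / 2 - 1) : ℝ) : ℂ) *
        ∫ k, (Real.exp (-(Real.pi * t * ‖k‖ ^ 2)) : ℂ) * 𝓕 A k := by
    -- The substitution `t ↦ t⁻¹` absorbs the factor `t ^ (-d / 2)` of the Gaussian transform and
    -- exchanges `s` with `d - s`.
    rw [← integral_comp_rpow_Ioi (fun t : ℝ => ((t ^ ((d - s) / 2 - 1) : ℝ) : ℂ) *
        ∫ k, (Real.exp (-(Real.pi * t * ‖k‖ ^ 2)) : ℂ) * 𝓕 A k) (p := -1) (by norm_num)]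
    refine setIntegral_congr_fun measurableSet_Ioi fun t ht => ?_
    have ht' : (0 : ℝ) < t := ht
    rw [integral_gaussian_mul_eq hA ht', Real.rpow_neg_one, Complex.real_smul, ← mul_assoc,
      ← mul_assoc, ← Complex.ofReal_mul, ← Complex.ofReal_mul]
    congr 2
    rw [Real.inv_rpow ht'.le, ← Real.rpow_neg ht'.le, ← Real.rpow_add ht', abs_neg, abs_one,
      one_mul, ← Real.rpow_add ht']
    congr 1
    ring
  have h1 := Real.Gamma_pos_of_pos (half_pos hs)
  have hne : Real.pi ^ (-s / 2) * Gamma (s / 2) ≠ 0 := by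
    have := Real.pi_pos
    positivity
  rw [e1, e2] at e3
  rw [rieszConst, Complex.ofReal_mul, mul_assoc, ← e3, ← mul_assoc, ← Complex.ofReal_mul,
    inv_mul_cancel₀ hne, Complex.ofReal_one, one_mul]

end

/-! ### Fourier multipliers of singular kernels -/

section

/-- The autocorrelation `z ↦ ∫ φ(x) conj(φ(x - z)) dx`. -/
def autocorr {d : ℕ} (φ : E d → ℂ) : E d → ℂ :=
  φ ⋆[ContinuousLinearMap.mul ℂ ℂ, volume] fun w => conj (φ (-w))

lemma autocorr_apply {d : ℕ} (φ : E d → ℂ) (z : E d) :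
    autocorr φ z = ∫ x, φ x * conj (φ (x - z)) := by
  simp [autocorr, convolution_def]

lemma hasCompactSupport_conj_neg {d : ℕ} {φ : E d → ℂ} (hφ : HasCompactSupport φ) :
    HasCompactSupport fun w => conj (φ (-w)) := by
  have h1 : HasCompactSupport fun w => φ (-w) := hφ.comp_homeomorph (Homeomorph.neg (E d))
  exact h1.comp_left (g := conj) (by simp)

lemma continuous_autocorr {d : ℕ} {φ : E d → ℂ} (hc : Continuous φ) (hφ : HasCompactSupport φ) :
    Continuous (autocorr φ) :=
  (hasCompactSupport_conj_neg hφ).continuous_convolution_right _ hc.locallyIntegrable (by fun_prop)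

lemma hasCompactSupport_autocorr {d : ℕ} {φ : E d → ℂ} (hφ : HasCompactSupport φ) :
    HasCompactSupport (autocorr φ) :=
  HasCompactSupport.convolution _ hφ (hasCompactSupport_conj_neg hφ)

lemma fourier_conj_neg {d : ℕ} (φ : E d → ℂ) (k : E d) :
    𝓕 (fun w => conj (φ (-w))) k = conj (𝓕 φ k) := by
  rw [Real.fourier_eq', Real.fourier_eq', ← integral_conj, ← integral_neg_eq_self]
  refine integral_congr_ae (Filter.Eventually.of_forall fun w => ?_)
  have h2 : conj (2 : ℂ) = 2 := Complex.conj_ofNat 2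
  simp [← Complex.exp_conj, h2]

lemma fourier_autocorr {d : ℕ} {φ : E d → ℂ} (hc : Continuous φ) (hφ : HasCompactSupport φ)
    (k : E d) : 𝓕 (autocorr φ) k = ((‖𝓕 φ k‖ ^ 2 : ℝ) : ℂ) := by
  have hi : Integrable φ := hc.integrable_of_hasCompactSupport hφ
  have hi' : Integrable fun w => conj (φ (-w)) :=
    Continuous.integrable_of_hasCompactSupport (by fun_prop) (hasCompactSupport_conj_neg hφ)
  rw [autocorr, Real.fourier_mul_convolution_eq hi hi', fourier_conj_neg, Complex.mul_conj']
  norm_cast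

lemma integrable_norm_sq_fourier {d : ℕ} {φ : E d → ℂ} (hφ : ContDiff ℝ ∞ φ)
    (hφ' : HasCompactSupport φ) : Integrable fun k => ‖𝓕 φ k‖ ^ 2 := by
  have h := (SchwartzMap.memLp (𝓕 (hφ'.toSchwartzMap hφ)) 2 volume).integrable_norm_pow
    (by norm_num)
  rw [SchwartzMap.fourier_coe] at h
  exact h

/-- When both `φ x` and `φ (x - z)` are nonzero, `x` and `x - z` lie in a ball of radius `r`, so
`‖z‖ ≤ r + r`. Only the restriction of `K` to a compact ball matters. -/
lemma integrable_double_form {d : ℕ} {K : E d → ℝ} (hK : LocallyIntegrable K)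
    {φ : E d → ℂ} (hc : Continuous φ) (hφ : HasCompactSupport φ) :
    Integrable (fun p : E d × E d => (K p.2 : ℂ) * φ p.1 * conj (φ (p.1 - p.2)))
      (volume.prod volume) := by
  obtain ⟨r, hr⟩ := hφ.isCompact.isBounded.subset_closedBall 0
  obtain ⟨b, hb⟩ := hc.bounded_above_of_compact_support hφ
  have hb0 : 0 ≤ b := (norm_nonneg _).trans (hb 0)
  have hKi : Integrable ((Metric.closedBall (0 : E d) (r + r)).indicator K) :=
    (integrable_indicator_iff measurableSet_closedBall).2
      (hK.integrableOn_isCompact (isCompact_closedBall _ _))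
  have hi : Integrable φ := hc.integrable_of_hasCompactSupport hφ
  have hprod := (hi.norm.mul_prod (hKi.norm.const_mul b))
  refine hprod.mono' ?_ (Filter.Eventually.of_forall ?_)
  · refine AEStronglyMeasurable.mul (AEStronglyMeasurable.mul ?_ ?_) ?_
    · exact (Complex.continuous_ofReal.comp_aestronglyMeasurable
        hK.aestronglyMeasurable).comp_snd
    · exact (by fun_prop : Continuous fun p : E d × E d => φ p.1).aestronglyMeasurable
    · exact (by fun_prop :
        Continuous fun p : E d × E d => conj (φ (p.1 - p.2))).aestronglyMeasurable
  · rintro ⟨x, z⟩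
    simp only [norm_mul, RCLike.norm_conj, Complex.norm_real]
    by_cases h0 : φ x = 0 ∨ φ (x - z) = 0
    · have h1 : ‖K z‖ * ‖φ x‖ * ‖φ (x - z)‖ = 0 := by rcases h0 with h | h <;> simp [h]
      rw [h1]
      positivity
    · push Not at h0
      have hx : ‖x‖ ≤ r := by simpa using hr (subset_tsupport _ h0.1)
      have hxz : ‖x - z‖ ≤ r := by simpa using hr (subset_tsupport _ h0.2)
      have hz : z ∈ Metric.closedBall (0 : E d) (r + r) := by
        have : ‖z‖ ≤ ‖x‖ + ‖x - z‖ := by simpa using norm_sub_le x (x - z)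
        simpa using this.trans (add_le_add hx hxz)
      rw [indicator_of_mem hz]
      calc ‖K z‖ * ‖φ x‖ * ‖φ (x - z)‖ ≤ ‖K z‖ * ‖φ x‖ * b := by gcongr; exact hb _
        _ = _ := by ring

/-- Substituting `y = x - z` and applying Fubini puts all dependence on `φ` into its
autocorrelation. -/
lemma double_form_eq {d : ℕ} {K : E d → ℝ} (hK : LocallyIntegrable K)
    {φ : E d → ℂ} (hc : Continuous φ) (hφ : HasCompactSupport φ) :
    ∫ x, ∫ y, (K (x - y) : ℂ) * φ x * conj (φ y) = ∫ z, (K z : ℂ) * autocorr φ z := by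
  calc _ = ∫ x, ∫ z, (K z : ℂ) * φ x * conj (φ (x - z)) := by
        refine integral_congr_ae (Filter.Eventually.of_forall fun x => ?_)
        simp only
        rw [← integral_sub_left_eq_self
          (fun z => (K z : ℂ) * φ x * conj (φ (x - z))) volume x]
        simp
    _ = ∫ z, ∫ x, (K z : ℂ) * φ x * conj (φ (x - z)) :=
        integral_integral_swap (integrable_double_form hK hc hφ)
    _ = _ := by
        refine integral_congr_ae (Filter.Eventually.of_forall fun z => ?_)
        simp only
        rw [autocorr_apply, ← integral_const_mul]
        simp only [mul_assoc]

lemma integrable_mul_of_locallyIntegrable {d : ℕ} {K : E d → ℝ} (hK : LocallyIntegrable K)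
    {A : E d → ℂ} (hc : Continuous A) (hA : HasCompactSupport A) :
    Integrable fun z => (K z : ℂ) * A z := by
  have := hK.integrable_smul_right_of_hasCompactSupport hc hA
  refine this.congr (Filter.Eventually.of_forall fun z => ?_)
  simp

/-- The locally integrable kernel `K` acts on autocorrelations of test functions as the Fourier
multiplier `σ`. -/
structure HasSymbol {d : ℕ} (K σ : E d → ℝ) : Prop where
  locallyIntegrable : LocallyIntegrable K
  integrable : ∀ φ : E d → ℂ, ContDiff ℝ ∞ φ → HasCompactSupport φ →
    Integrable fun k => σ k * ‖𝓕 φ k‖ ^ 2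
  integral_eq : ∀ φ : E d → ℂ, ContDiff ℝ ∞ φ → HasCompactSupport φ →
    ∫ z, (K z : ℂ) * autocorr φ z = ((∫ k, σ k * ‖𝓕 φ k‖ ^ 2 : ℝ) : ℂ)

namespace HasSymbol

variable {d : ℕ} {K K' σ σ' : E d → ℝ}

lemma isPositiveDefinite (h : HasSymbol K σ) (hσ : ∀ᵐ k, 0 ≤ σ k) : IsPositiveDefinite K := by
  refine ⟨h.locallyIntegrable, fun φ hφ hφ' => ?_⟩
  rw [double_form_eq h.locallyIntegrable hφ.continuous hφ', h.integral_eq φ hφ hφ']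
  rw [Complex.zero_le_real]
  refine integral_nonneg_of_ae ?_
  filter_upwards [hσ] with k hk
  simp only [Pi.zero_apply]
  positivity

lemma add (h : HasSymbol K σ) (h' : HasSymbol K' σ') :
    HasSymbol (fun x => K x + K' x) (fun k => σ k + σ' k) where
  locallyIntegrable := h.locallyIntegrable.add h'.locallyIntegrable
  integrable φ hφ hφ' := by
    simp only [add_mul]
    exact (h.integrable φ hφ hφ').add (h'.integrable φ hφ hφ')
  integral_eq φ hφ hφ' := by
    have hc := continuous_autocorr hφ.continuous hφ'
    have hA := hasCompactSupport_autocorr hφ'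
    simp only [Complex.ofReal_add, add_mul]
    rw [integral_add (integrable_mul_of_locallyIntegrable h.locallyIntegrable hc hA)
      (integrable_mul_of_locallyIntegrable h'.locallyIntegrable hc hA),
      integral_add (h.integrable φ hφ hφ') (h'.integrable φ hφ hφ'), h.integral_eq φ hφ hφ',
      h'.integral_eq φ hφ hφ', Complex.ofReal_add]

lemma const_mul (h : HasSymbol K σ) (c : ℝ) :
    HasSymbol (fun x => c * K x) (fun k => c * σ k) where
  locallyIntegrable := h.locallyIntegrable.smul c
  integrable φ hφ hφ' := by
    simpa only [mul_assoc] using (h.integrable φ hφ hφ').const_mul c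
  integral_eq φ hφ hφ' := by
    simp only [Complex.ofReal_mul, mul_assoc]
    rw [integral_const_mul, integral_const_mul, h.integral_eq φ hφ hφ', Complex.ofReal_mul]

lemma sub (h : HasSymbol K σ) (h' : HasSymbol K' σ') :
    HasSymbol (fun x => K x - K' x) (fun k => σ k - σ' k) := by
  simpa [sub_eq_add_neg] using h.add (h'.const_mul (-1))

lemma sum {ι : Type*} (t : Finset ι) {K σ : ι → E d → ℝ} (h : ∀ i ∈ t, HasSymbol (K i) (σ i)) :
    HasSymbol (fun x => ∑ i ∈ t, K i x) (fun k => ∑ i ∈ t, σ i k) := by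
  classical
  induction t using Finset.induction_on with
  | empty =>
    refine ⟨?_, ?_, ?_⟩
    · simpa using (locallyIntegrable_zero : LocallyIntegrable (fun _ : E d => (0 : ℝ)))
    · simp
    · simp
  | insert a t ha ih =>
    simp only [Finset.sum_insert ha]
    exact (h a (by simp)).add (ih fun i hi => h i (by simp [hi]))

end HasSymbol

lemma integrable_autocorr {d : ℕ} {φ : E d → ℂ} (hφ : ContDiff ℝ ∞ φ)
    (hφ' : HasCompactSupport φ) : Integrable (autocorr φ) :=
  (continuous_autocorr hφ.continuous hφ').integrable_of_hasCompactSupport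
    (hasCompactSupport_autocorr hφ')

lemma integrable_fourier_autocorr {d : ℕ} {φ : E d → ℂ} (hφ : ContDiff ℝ ∞ φ)
    (hφ' : HasCompactSupport φ) : Integrable (𝓕 (autocorr φ)) := by
  refine (integrable_norm_sq_fourier hφ hφ').ofReal.congr
    (Filter.Eventually.of_forall fun k => ?_)
  rw [fourier_autocorr hφ.continuous hφ']
  rfl

/-- The uniform bound needed to integrate `‖𝓕 φ‖ ^ 2` against a singular symbol. -/
lemma norm_sq_fourier_le {d : ℕ} {φ : E d → ℂ} (hφ : ContDiff ℝ ∞ φ)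
    (hφ' : HasCompactSupport φ) (k : E d) : ‖𝓕 φ k‖ ^ 2 ≤ ∫ z, ‖autocorr φ z‖ := by
  have h := norm_fourier_le (autocorr φ) k
  rw [fourier_autocorr hφ.continuous hφ', Complex.norm_real, Real.norm_of_nonneg (by positivity)]
    at h
  exact h

lemma hasSymbol_riesz {d : ℕ} (hd : 1 ≤ d) {s : ℝ} (hs : 0 < s) (hsd : s < d) :
    HasSymbol (fun x : E d => ‖x‖ ^ (-s)) (fun k => rieszConst d s * ‖k‖ ^ (-(d - s))) where
  locallyIntegrable := locallyIntegrable_riesz hd hsd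
  integrable φ hφ hφ' := by
    have := integrable_riesz_mul hd (sub_pos.2 hsd).le (by linarith)
      (integrable_norm_sq_fourier hφ hφ') (fun _ => by positivity) (norm_sq_fourier_le hφ hφ') 0
    simpa [mul_assoc] using this.const_mul (rieszConst d s)
  integral_eq φ hφ hφ' := by
    rw [integral_riesz_mul_eq hd hs hsd (continuous_autocorr hφ.continuous hφ')
      (integrable_autocorr hφ hφ') (integrable_fourier_autocorr hφ hφ')]
    simp_rw [fourier_autocorr hφ.continuous hφ', mul_assoc, ← Complex.ofReal_mul]
    rw [integral_complex_ofReal, ← Complex.ofReal_mul, integral_const_mul]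

/-- Integrability on the product of a Riesz kernel with a moving singularity. -/
lemma integrable_riesz_prod {d : ℕ} (hd : 1 ≤ d) {s : ℝ} (hs : 0 ≤ s) (hsd : s < d)
    {f g : E d → ℂ} (hf : Integrable f) {b : ℝ} (hfb : ∀ z, ‖f z‖ ≤ b) (hg : Integrable g)
    {L : E d → E d} (hL : Measurable L) :
    Integrable (fun p : E d × E d => g p.1 * (((‖p.2 - L p.1‖ ^ (-s) : ℝ) : ℂ) * f p.2))
      (volume.prod volume) := by
  have hm : AEStronglyMeasurable
      (fun p : E d × E d => g p.1 * (((‖p.2 - L p.1‖ ^ (-s) : ℝ) : ℂ) * f p.2))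
      (volume.prod volume) := by
    refine hg.aestronglyMeasurable.comp_fst.mul
      (AEStronglyMeasurable.mul ?_ hf.aestronglyMeasurable.comp_snd)
    exact Measurable.aestronglyMeasurable (by fun_prop)
  rw [integrable_prod_iff hm]
  refine ⟨Filter.Eventually.of_forall fun y => ?_, ?_⟩
  · exact (integrable_riesz_mul_complex hd hs hsd hf hfb (L y)).const_mul (g y)
  · refine (hg.norm.mul_const (b * ballRiesz d s + ∫ z, ‖f z‖)).mono' hm.norm.integral_prod_right'
      (Filter.Eventually.of_forall fun y => ?_)
    simp only [norm_mul]
    rw [integral_const_mul, norm_mul, norm_norm]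
    refine mul_le_mul_of_nonneg_left ?_ (norm_nonneg _)
    rw [Real.norm_of_nonneg (integral_nonneg fun _ => by positivity)]
    -- The inner integral is bounded independently of `L y`, so integrability of `g` suffices for
    -- the outer one.
    have := integral_riesz_mul_le hd hs hsd hf.norm (fun _ => norm_nonneg _) hfb (L y)
    refine le_trans (le_of_eq ?_) this
    refine integral_congr_ae (Filter.Eventually.of_forall fun z => ?_)
    simp only
    rw [Complex.norm_real, Real.norm_of_nonneg (by positivity)]

/-- The character `exp (2 π i ⟨l, z⟩)`. -/
def chi {d : ℕ} (l z : E d) : ℂ := Complex.exp ((2 * Real.pi * inner ℝ l z : ℝ) * Complex.I)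

lemma norm_chi {d : ℕ} (l z : E d) : ‖chi l z‖ = 1 := Complex.norm_exp_ofReal_mul_I _

lemma chi_comm {d : ℕ} (l z : E d) : chi l z = chi z l := by rw [chi, chi, real_inner_comm]

lemma chi_smul {d : ℕ} (r : ℝ) (l z : E d) : chi l (r • z) = chi (r • l) z := by
  rw [chi, chi, inner_smul_left, inner_smul_right]
  simp

@[fun_prop]
lemma continuous_chi {X : Type*} [TopologicalSpace X] {d : ℕ} {f g : X → E d}
    (hf : Continuous f) (hg : Continuous g) : Continuous fun x => chi (f x) (g x) := by
  unfold FeffermanGregg.chi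
  fun_prop

lemma fourierInv_eq_chi {d : ℕ} (f : E d → ℂ) (z : E d) : 𝓕⁻ f z = ∫ l, chi l z * f l := by
  rw [Real.fourierInv_eq']
  rfl

lemma fourier_eq_chi {d : ℕ} (f : E d → ℂ) (k : E d) : 𝓕 f k = ∫ z, chi (-k) z * f z := by
  rw [Real.fourier_eq']
  refine integral_congr_ae (Filter.Eventually.of_forall fun z => ?_)
  simp [chi, real_inner_comm]

lemma chi_add_left {d : ℕ} (k l z : E d) : chi (k + l) z = chi k z * chi l z := by
  rw [chi, chi, chi, ← Complex.exp_add, inner_add_left]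
  congr 1
  push_cast
  ring

lemma fourier_chi_mul {d : ℕ} (f : E d → ℂ) (l k : E d) :
    𝓕 (fun z => chi l z * f z) k = 𝓕 f (k - l) := by
  rw [fourier_eq_chi, fourier_eq_chi]
  refine integral_congr_ae (Filter.Eventually.of_forall fun z => ?_)
  simp only
  rw [neg_sub, sub_eq_add_neg, add_comm l, chi_add_left, mul_assoc]

lemma fourier_translate {d : ℕ} (f : E d → ℂ) (y k : E d) :
    𝓕 (fun z => f (z + y)) k = chi k y * 𝓕 f k := by
  rw [fourier_eq_chi, fourier_eq_chi, ← integral_sub_right_eq_self _ y, ← integral_const_mul]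
  refine integral_congr_ae (Filter.Eventually.of_forall fun z => ?_)
  simp only [sub_add_cancel]
  rw [← mul_assoc]
  congr 1
  rw [chi, chi, chi, ← Complex.exp_add, inner_neg_left, inner_sub_right, inner_neg_left]
  congr 1
  push_cast
  ring

lemma integrable_chi_mul {d : ℕ} {f : E d → ℂ} (hf : Integrable f) (l : E d) :
    Integrable fun z => chi l z * f z := by
  refine hf.norm.mono' ?_ (Filter.Eventually.of_forall fun z => ?_)
  · exact (by fun_prop : Continuous fun z => chi l z).aestronglyMeasurable.mul
      hf.aestronglyMeasurable
  · rw [norm_mul, norm_chi, one_mul]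

lemma integral_chi_mul_swap {d : ℕ} {f g : E d → ℂ} (hf : Integrable f) (hg : Integrable g)
    (r : ℝ) : ∫ z, (∫ l, chi l (r • z) * g l) * f z = ∫ l, g l * ∫ z, chi (r • l) z * f z := by
  have hi : Integrable (fun p : E d × E d => chi p.2 (r • p.1) * (f p.1 * g p.2))
      (volume.prod volume) := by
    refine (hf.mul_prod hg).norm.mono' ?_ (Filter.Eventually.of_forall fun p => ?_)
    · exact (by fun_prop :
        Continuous fun p : E d × E d => chi p.2 (r • p.1)).aestronglyMeasurable.mul
        (hf.mul_prod hg).aestronglyMeasurable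
    · rw [norm_mul, norm_chi, one_mul]
  calc _ = ∫ z, ∫ l, chi l (r • z) * (f z * g l) := by
        refine integral_congr_ae (Filter.Eventually.of_forall fun z => ?_)
        simp only
        rw [← integral_mul_const]
        refine integral_congr_ae (Filter.Eventually.of_forall fun l => ?_)
        ring
    _ = ∫ l, ∫ z, chi l (r • z) * (f z * g l) := integral_integral_swap hi
    _ = _ := by
        refine integral_congr_ae (Filter.Eventually.of_forall fun l => ?_)
        simp only
        rw [← integral_const_mul]
        refine integral_congr_ae (Filter.Eventually.of_forall fun z => ?_)
        simp only
        rw [chi_smul]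
        ring

/-- Homogeneity of the kernel. Sums are written as differences with a negated point to match the
shape `‖z - y‖` of the integral estimates. -/
lemma riesz_scale {d : ℕ} {R : ℝ} (hR : 0 < R) (a : ℝ) (k l : E d) :
    ‖k - (-(R⁻¹ • l))‖ ^ (-a) = R ^ a * ‖l - (-(R • k))‖ ^ (-a) := by
  have h : k - (-(R⁻¹ • l)) = R⁻¹ • (l - (-(R • k))) := by
    rw [smul_sub, smul_neg, smul_smul, inv_mul_cancel₀ hR.ne', one_smul]
    abel
  rw [h, norm_smul, norm_inv, Real.norm_of_nonneg hR.le,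
    Real.mul_rpow (by positivity) (norm_nonneg _), Real.inv_rpow hR.le, Real.rpow_neg hR.le,
    inv_inv]

/-- The multiplier of the product of a Riesz kernel with a dilated inverse Fourier transform. -/
theorem hasSymbol_mul_riesz {d : ℕ} (hd : 1 ≤ d) {s : ℝ} (hs : 0 < s) (hsd : s < d)
    {Q m : E d → ℝ} (hQ : Continuous Q) (hm : Integrable m)
    (hQm : ∀ z, (Q z : ℂ) = ∫ l, chi l z * (m l : ℂ)) {R : ℝ} (hR : 0 < R) :
    HasSymbol (fun x : E d => Q (R⁻¹ • x) * ‖x‖ ^ (-s)) (fun k => rieszConst d s *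
      (R ^ (d - s) * ∫ l, ‖l - (-(R • k))‖ ^ (-(d - s)) * m l)) := by
  have hds : 0 < d - s := sub_pos.2 hsd
  have hQb : ∀ z, |Q z| ≤ ∫ l, |m l| := by
    intro z
    rw [← Real.norm_eq_abs, ← Complex.norm_real, hQm]
    refine (norm_integral_le_integral_norm _).trans_eq ?_
    refine integral_congr_ae (Filter.Eventually.of_forall fun l => ?_)
    simp [norm_chi]
  have hmul : ∀ φ : E d → ℂ, ContDiff ℝ ∞ φ → HasCompactSupport φ →
      Integrable (fun p : E d × E d => (m p.1 : ℂ) *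
        (((‖p.2 - (-(R⁻¹ • p.1))‖ ^ (-(d - s)) : ℝ) : ℂ) * ((‖𝓕 φ p.2‖ ^ 2 : ℝ) : ℂ)))
        (volume.prod volume) := by
    intro φ hφ hφ'
    refine integrable_riesz_prod hd hds.le (by linarith)
      (integrable_norm_sq_fourier hφ hφ').ofReal (b := ∫ z, ‖autocorr φ z‖) (fun k => ?_)
      hm.ofReal (L := fun l => -(R⁻¹ • l)) (by fun_prop)
    rw [RCLike.norm_ofReal, abs_of_nonneg (by positivity)]
    exact norm_sq_fourier_le hφ hφ' k
  have hin : ∀ (φ : E d → ℂ) (k : E d), ∫ l, (m l : ℂ) *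
      (((‖k - (-(R⁻¹ • l))‖ ^ (-(d - s)) : ℝ) : ℂ) * ((‖𝓕 φ k‖ ^ 2 : ℝ) : ℂ))
      = (((R ^ (d - s) * ∫ l, ‖l - (-(R • k))‖ ^ (-(d - s)) * m l) * ‖𝓕 φ k‖ ^ 2 : ℝ) : ℂ) := by
    intro φ k
    rw [← integral_const_mul, ← integral_mul_const, ← integral_complex_ofReal]
    refine integral_congr_ae (Filter.Eventually.of_forall fun l => ?_)
    simp only
    rw [riesz_scale hR]
    push_cast
    ring
  refine ⟨?_, fun φ hφ hφ' => ?_, fun φ hφ hφ' => ?_⟩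
  · refine locallyIntegrable_of_norm_le_rpow (by simpa using hd) (C := ∫ l, |m l|) (α := s)
      (by simpa using hsd) (Filter.Eventually.of_forall fun x => ?_) ?_
    · rw [norm_mul, Real.norm_of_nonneg (Real.rpow_nonneg (norm_nonneg x) _)]
      exact mul_le_mul_of_nonneg_right (hQb _) (by positivity)
    · exact (by fun_prop : Continuous fun x : E d => Q (R⁻¹ • x)).aestronglyMeasurable.mul
        (by fun_prop : Measurable fun z : E d => ‖z‖ ^ (-s)).aestronglyMeasurable
  · have h := (hmul φ hφ hφ').integral_prod_right
    simp only [hin] at h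
    refine (h.re.const_mul (rieszConst d s)).congr (Filter.Eventually.of_forall fun k => ?_)
    simp only [RCLike.re_to_complex, Complex.ofReal_re, mul_assoc]
  · have hc := continuous_autocorr hφ.continuous hφ'
    have hi := integrable_autocorr hφ hφ'
    have hi' := integrable_fourier_autocorr hφ hφ'
    have hri := integrable_riesz_mul_complex hd hs.le hsd hi
      (norm_le_integral_fourier hc hi hi') 0
    simp only [sub_zero] at hri
    calc ∫ z, ((Q (R⁻¹ • z) * ‖z‖ ^ (-s) : ℝ) : ℂ) * autocorr φ z
        = ∫ z, (∫ l, chi l (R⁻¹ • z) * (m l : ℂ)) *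
            (((‖z‖ ^ (-s) : ℝ) : ℂ) * autocorr φ z) := by
          refine integral_congr_ae (Filter.Eventually.of_forall fun z => ?_)
          simp only
          rw [← hQm, Complex.ofReal_mul, mul_assoc]
      _ = ∫ l, (m l : ℂ) * ∫ z, chi (R⁻¹ • l) z * (((‖z‖ ^ (-s) : ℝ) : ℂ) * autocorr φ z) :=
          integral_chi_mul_swap hri hm.ofReal R⁻¹
      _ = ∫ l, (rieszConst d s : ℂ) * ∫ k, (m l : ℂ) *
            (((‖k - (-(R⁻¹ • l))‖ ^ (-(d - s)) : ℝ) : ℂ) * ((‖𝓕 φ k‖ ^ 2 : ℝ) : ℂ)) := by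
          refine integral_congr_ae (Filter.Eventually.of_forall fun l => ?_)
          simp only
          -- Modulation by a character translates the Fourier transform; changing variables then
          -- moves the translation onto the Riesz symbol.
          have hF : 𝓕 (fun z => chi (R⁻¹ • l) z * autocorr φ z)
              = fun k => 𝓕 (autocorr φ) (k - R⁻¹ • l) := by
            ext k
            exact fourier_chi_mul _ _ _
          have := integral_riesz_mul_eq hd hs hsd (A := fun z => chi (R⁻¹ • l) z * autocorr φ z)
            (by fun_prop) (integrable_chi_mul hi _) (by rw [hF]; exact hi'.comp_sub_right _)
          rw [hF] at this
          rw [integral_const_mul, ← mul_assoc, mul_comm (rieszConst d s : ℂ), mul_assoc]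
          congr 1
          calc _ = ∫ z, ((‖z‖ ^ (-s) : ℝ) : ℂ) * (chi (R⁻¹ • l) z * autocorr φ z) := by
                refine integral_congr_ae (Filter.Eventually.of_forall fun z => ?_)
                simp only
                ring
            _ = _ := by
                rw [this, ← integral_add_right_eq_self (fun k => _) (R⁻¹ • l)]
                congr 1
                refine integral_congr_ae (Filter.Eventually.of_forall fun k => ?_)
                simp [fourier_autocorr hφ.continuous hφ']
      _ = ((∫ k, rieszConst d s * (R ^ (d - s) * ∫ l, ‖l - (-(R • k))‖ ^ (-(d - s)) * m l) *
            ‖𝓕 φ k‖ ^ 2 : ℝ) : ℂ) := by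
          rw [integral_const_mul, integral_integral_swap (hmul φ hφ hφ')]
          simp_rw [hin, mul_assoc (rieszConst d s)]
          rw [integral_complex_ofReal, integral_const_mul, Complex.ofReal_mul]

/-- The multiplier of the convolution of a Riesz kernel with a test function. -/
theorem hasSymbol_convolution_riesz {d : ℕ} (hd : 1 ≤ d) {s : ℝ} (hs : 0 < s) (hsd : s < d)
    {Q n : E d → ℝ} (hQ : Continuous Q) (hQc : HasCompactSupport Q)
    (hn : ∀ k, ∫ y, chi y k * (Q y : ℂ) = (n k : ℂ)) :
    HasSymbol (fun x : E d => ∫ y, Q y * ‖x - y‖ ^ (-s))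
      (fun k => rieszConst d s * (‖k‖ ^ (-(d - s)) * n k)) := by
  have hds : 0 < d - s := sub_pos.2 hsd
  have hQi : Integrable Q := hQ.integrable_of_hasCompactSupport hQc
  have hP : ∀ φ : E d → ℂ, ContDiff ℝ ∞ φ → HasCompactSupport φ →
      Integrable fun k => ‖k‖ ^ (-(d - s)) * ‖𝓕 φ k‖ ^ 2 := by
    intro φ hφ hφ'
    have := integrable_riesz_mul hd hds.le (by linarith)
      (integrable_norm_sq_fourier hφ hφ') (fun _ => by positivity) (norm_sq_fourier_le hφ hφ') 0
    simpa using this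
  have hnb : ∀ k, ‖n k‖ ≤ ∫ y, ‖Q y‖ := by
    intro k
    rw [← Complex.norm_real, ← hn]
    refine (norm_integral_le_integral_norm _).trans_eq ?_
    refine integral_congr_ae (Filter.Eventually.of_forall fun l => ?_)
    simp [norm_chi]
  -- Measurability of `n` comes from its expression as a parametric integral.
  have hnc : AEStronglyMeasurable n := by
    have h1 : AEStronglyMeasurable (fun p : E d × E d => chi p.2 p.1 * (Q p.2 : ℂ))
        (volume.prod volume) := Continuous.aestronglyMeasurable (by fun_prop)
    have h2 := h1.integral_prod_right'
    simp only [hn] at h2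
    simpa using h2.re
  refine ⟨?_, fun φ hφ hφ' => ?_, fun φ hφ hφ' => ?_⟩
  · have := (hQc.continuous_convolution_right (ContinuousLinearMap.mul ℝ ℝ)
      (locallyIntegrable_riesz hd hsd) hQ).locallyIntegrable (μ := volume)
    refine this.congr (Filter.Eventually.of_forall fun x => ?_)
    simp only
    rw [convolution_eq_swap]
    refine integral_congr_ae (Filter.Eventually.of_forall fun y => ?_)
    simp [mul_comm]
  · have := (((hP φ hφ hφ').bdd_mul hnc (Filter.Eventually.of_forall hnb))).const_mul
      (rieszConst d s)
    refine this.congr (Filter.Eventually.of_forall fun k => ?_)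
    simp only
    ring
  · have hc := continuous_autocorr hφ.continuous hφ'
    have hi := integrable_autocorr hφ hφ'
    have hi' := integrable_fourier_autocorr hφ hφ'
    have hpr := integrable_riesz_prod hd hs.le hsd hi (norm_le_integral_fourier hc hi hi')
      hQi.ofReal (L := fun y => y) measurable_id
    calc ∫ z, ((∫ y, Q y * ‖z - y‖ ^ (-s) : ℝ) : ℂ) * autocorr φ z
        = ∫ z, ∫ y, (Q y : ℂ) * (((‖z - y‖ ^ (-s) : ℝ) : ℂ) * autocorr φ z) := by
          refine integral_congr_ae (Filter.Eventually.of_forall fun z => ?_)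
          simp only
          rw [← integral_complex_ofReal, ← integral_mul_const]
          refine integral_congr_ae (Filter.Eventually.of_forall fun y => ?_)
          simp only
          push_cast
          ring
      _ = ∫ y, ∫ z, (Q y : ℂ) * (((‖z - y‖ ^ (-s) : ℝ) : ℂ) * autocorr φ z) :=
          (integral_integral_swap hpr).symm
      -- Translating the autocorrelation multiplies its transform by a character. The dummy factor
      -- `(1 : ℝ) •` matches `integral_chi_mul_swap` at scale `1`.
      _ = ∫ y, (rieszConst d s : ℂ) * ((Q y : ℂ) * ∫ k, chi ((1 : ℝ) • y) k *
            ((‖k‖ ^ (-(d - s)) * ‖𝓕 φ k‖ ^ 2 : ℝ) : ℂ)) := by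
          refine integral_congr_ae (Filter.Eventually.of_forall fun y => ?_)
          simp only
          have hF : 𝓕 (fun z => autocorr φ (z + y))
              = fun k => chi y k * 𝓕 (autocorr φ) k := by
            ext k
            rw [fourier_translate, chi_comm]
          have := integral_riesz_mul_eq hd hs hsd (A := fun z => autocorr φ (z + y))
            (by fun_prop) (hi.comp_add_right y) (by rw [hF]; exact integrable_chi_mul hi' y)
          rw [hF] at this
          rw [integral_const_mul, ← mul_assoc, mul_comm (rieszConst d s : ℂ), mul_assoc]
          congr 1
          calc _ = ∫ z, ((‖z‖ ^ (-s) : ℝ) : ℂ) * autocorr φ (z + y) := by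
                rw [← integral_add_right_eq_self (fun z => _) y]
                simp
            _ = _ := by
                rw [this]
                congr 1
                refine integral_congr_ae (Filter.Eventually.of_forall fun k => ?_)
                simp only [one_smul]
                rw [fourier_autocorr hφ.continuous hφ']
                push_cast
                ring
      _ = ((∫ k, rieszConst d s * (‖k‖ ^ (-(d - s)) * n k) * ‖𝓕 φ k‖ ^ 2 : ℝ) : ℂ) := by
          have hsw : ∫ k, (∫ l, chi l ((1 : ℝ) • k) * (Q l : ℂ)) *
              ((‖k‖ ^ (-(d - s)) * ‖𝓕 φ k‖ ^ 2 : ℝ) : ℂ) = ∫ l, (Q l : ℂ) *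
              ∫ k, chi ((1 : ℝ) • l) k * ((‖k‖ ^ (-(d - s)) * ‖𝓕 φ k‖ ^ 2 : ℝ) : ℂ) :=
            integral_chi_mul_swap (hP φ hφ hφ').ofReal hQi.ofReal 1
          rw [integral_const_mul, ← hsw, ← integral_complex_ofReal, ← integral_const_mul]
          refine integral_congr_ae (Filter.Eventually.of_forall fun k => ?_)
          simp only [one_smul]
          rw [hn]
          push_cast
          ring

end

/-! ### The overlap function of the unit ball -/

section

variable {d : ℕ}

lemma indB_of_le {r : ℝ} {x : E d} (h : ‖x‖ ≤ r) : indB d r x = 1 :=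
  indicator_of_mem (by simpa [B] using h) _

lemma indB_of_lt {r : ℝ} {x : E d} (h : r < ‖x‖) : indB d r x = 0 :=
  indicator_of_notMem (by simpa [B] using h) _

lemma indB_nonneg (r : ℝ) (x : E d) : 0 ≤ indB d r x :=
  indicator_nonneg (fun _ _ => zero_le_one) _

lemma indB_le_one (r : ℝ) (x : E d) : indB d r x ≤ 1 :=
  indicator_le_self' (fun _ _ => zero_le_one) _

lemma measurable_indB (r : ℝ) : Measurable (indB d r) :=
  measurable_one.indicator Metric.isClosed_closedBall.measurableSet

lemma integrable_indB (r : ℝ) : Integrable (indB d r) :=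
  (integrable_indicator_iff Metric.isClosed_closedBall.measurableSet).2
    (integrableOn_const (measure_closedBall_lt_top.ne))

lemma integral_indB (r : ℝ) : ∫ x, indB d r x = volB d r := by
  rw [indB, B, integral_indicator Metric.isClosed_closedBall.measurableSet]
  simp [volB, B]

lemma indB_smul {t : ℝ} (ht : 0 < t) (y : E d) : indB d t y = indB d 1 (t⁻¹ • y) := by
  have : ‖t⁻¹ • y‖ = ‖y‖ / t := by
    rw [norm_smul, norm_inv, Real.norm_of_nonneg ht.le, div_eq_inv_mul]
  rcases le_or_gt ‖y‖ t with h | h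
  · rw [indB_of_le h, indB_of_le (by rw [this, div_le_one ht]; exact h)]
  · rw [indB_of_lt h, indB_of_lt (by rw [this, one_lt_div ht]; exact h)]

lemma volB_eq {t : ℝ} (ht : 0 ≤ t) : volB d t = t ^ d * volB d 1 := by
  have := Measure.addHaar_real_closedBall' (volume : Measure (E d)) 0 ht
  simpa [volB, B] using this

lemma volB_one_pos : 0 < volB d 1 :=
  ENNReal.toReal_pos (Metric.measure_closedBall_pos _ _ one_pos).ne' measure_closedBall_lt_top.ne

lemma ballConv_apply (r : ℝ) (x : E d) : ballConv d r x = ∫ y, indB d r y * indB d r (x - y) := by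
  simp [ballConv, convolution_def]

lemma ballConv_eq {t : ℝ} (ht : 0 < t) (x : E d) :
    ballConv d t x = t ^ d * ballConv d 1 (t⁻¹ • x) := by
  rw [ballConv_apply, ballConv_apply]
  have := Measure.integral_comp_inv_smul_of_nonneg (volume : Measure (E d))
    (fun y => indB d 1 y * indB d 1 (t⁻¹ • x - y)) ht.le
  simp only [smul_eq_mul, finrank_euclideanSpace, Fintype.card_fin] at this
  rw [← this]
  refine integral_congr_ae (Filter.Eventually.of_forall fun y => ?_)
  simp only
  rw [indB_smul ht, indB_smul ht, smul_sub]

lemma integrable_indB_mul (r : ℝ) (x : E d) :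
    Integrable fun y => indB d r y * indB d r (x - y) := by
  refine (integrable_indB r).mono' ?_ (Filter.Eventually.of_forall fun y => ?_)
  · exact ((measurable_indB r).mul ((measurable_indB r).comp
      (measurable_const.sub measurable_id))).aestronglyMeasurable
  · rw [Real.norm_of_nonneg (mul_nonneg (indB_nonneg _ _) (indB_nonneg _ _))]
    exact mul_le_of_le_one_right (indB_nonneg _ _) (indB_le_one _ _)

lemma ballConv_nonneg (r : ℝ) (x : E d) : 0 ≤ ballConv d r x := by
  rw [ballConv_apply]
  exact integral_nonneg fun y => mul_nonneg (indB_nonneg _ _) (indB_nonneg _ _)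

lemma ballConv_le (r : ℝ) (x : E d) : ballConv d r x ≤ volB d r := by
  rw [ballConv_apply, ← integral_indB]
  exact integral_mono (integrable_indB_mul r x) (integrable_indB r) fun y =>
    mul_le_of_le_one_right (indB_nonneg _ _) (indB_le_one _ _)

lemma ballConv_zero (r : ℝ) : ballConv d r 0 = volB d r := by
  rw [ballConv_apply, ← integral_indB]
  refine integral_congr_ae (Filter.Eventually.of_forall fun y => ?_)
  simp only [zero_sub]
  rcases le_or_gt ‖y‖ r with h | h
  · rw [indB_of_le h, indB_of_le (by rwa [norm_neg]), one_mul]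
  · rw [indB_of_lt h, zero_mul]

lemma ballConv_eq_zero {r : ℝ} {x : E d} (hx : 2 * r < ‖x‖) : ballConv d r x = 0 := by
  rw [ballConv_apply]
  refine integral_eq_zero_of_ae (Filter.Eventually.of_forall fun y => ?_)
  simp only [Pi.zero_apply]
  rcases le_or_gt ‖y‖ r with h | h
  · have : ‖x‖ ≤ ‖x - y‖ + ‖y‖ := by simpa using norm_add_le (x - y) y
    rw [indB_of_lt (x := x - y) (by linarith), mul_zero]
  · rw [indB_of_lt h, zero_mul]

/-- If exactly one of `p`, `q` lies in the unit ball, then `‖p‖` is within `‖p - q‖` of `1`; the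
right side is the indicator of that shell. -/
lemma abs_indB_sub_le (p q : E d) :
    |indB d 1 p - indB d 1 q| ≤ indB d (1 + ‖p - q‖) p - indB d (1 - ‖p - q‖) p := by
  have hδ := norm_nonneg (p - q)
  have h1 : ‖p‖ ≤ ‖q‖ + ‖p - q‖ := by simpa using norm_add_le q (p - q)
  have h2 : ‖q‖ ≤ ‖p‖ + ‖p - q‖ := by
    have := norm_sub_le p (p - q)
    simpa using this
  rcases le_or_gt ‖p‖ (1 - ‖p - q‖) with h | h
  · rw [indB_of_le h, indB_of_le (r := 1 + _) (by linarith), indB_of_le (x := p) (by linarith),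
      indB_of_le (x := q) (by linarith)]
    simp
  · rw [indB_of_lt h, sub_zero]
    rcases le_or_gt ‖p‖ (1 + ‖p - q‖) with h' | h'
    · rw [indB_of_le h', abs_le]
      constructor <;> linarith [indB_nonneg 1 p, indB_nonneg 1 q, indB_le_one 1 p, indB_le_one 1 q]
    · rw [indB_of_lt h', indB_of_lt (x := p) (by linarith), indB_of_lt (x := q) (by linarith)]
      simp

/-- A convex function lies below its chord over `[0, 1]`. -/
lemma one_add_pow_le {δ : ℝ} (h0 : 0 ≤ δ) (h1 : δ ≤ 1) (n : ℕ) :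
    (1 + δ) ^ n ≤ 1 + δ * (2 ^ n - 1) := by
  induction n with
  | zero => simp
  | succ n ih =>
    have h2 : (1 : ℝ) ≤ 2 ^ n := one_le_pow₀ (by norm_num)
    calc (1 + δ) ^ (n + 1) = (1 + δ) ^ n * (1 + δ) := pow_succ _ _
      _ ≤ (1 + δ * (2 ^ n - 1)) * (1 + δ) := by gcongr
      _ ≤ 1 + δ * (2 ^ (n + 1) - 1) := by
        rw [pow_succ]
        nlinarith [mul_nonneg (mul_nonneg h0 (sub_nonneg.2 h1)) (sub_nonneg.2 h2)]

/-- The unit-scale normalized self-convolution of a ball. -/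
def ballOverlap (d : ℕ) (x : E d) : ℝ := ballConv d 1 x / volB d 1

lemma ballConv_div_volB {t : ℝ} (ht : 0 < t) (x : E d) :
    ballConv d t x / volB d t = ballOverlap d (t⁻¹ • x) := by
  rw [ballConv_eq ht, volB_eq ht.le, ballOverlap, mul_div_mul_left _ _ (by positivity)]

lemma ballOverlap_nonneg (x : E d) : 0 ≤ ballOverlap d x :=
  div_nonneg (ballConv_nonneg _ _) volB_one_pos.le

lemma ballOverlap_le_one (x : E d) : ballOverlap d x ≤ 1 :=
  (div_le_one volB_one_pos).2 (ballConv_le _ _)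

lemma ballOverlap_zero : ballOverlap d 0 = 1 := by
  rw [ballOverlap, ballConv_zero, div_self volB_one_pos.ne']

lemma ballOverlap_eq_zero {x : E d} (hx : 2 < ‖x‖) : ballOverlap d x = 0 := by
  rw [ballOverlap, ballConv_eq_zero (by linarith), zero_div]

lemma abs_ballConv_sub_le (x y : E d) :
    |ballConv d 1 x - ballConv d 1 y| ≤ volB d (1 + ‖x - y‖) - volB d (1 - ‖x - y‖) := by
  rw [ballConv_apply, ballConv_apply,
    ← integral_sub (integrable_indB_mul 1 x) (integrable_indB_mul 1 y), ← Real.norm_eq_abs,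
    ← integral_indB, ← integral_indB, ← integral_sub (integrable_indB _) (integrable_indB _),
    ← integral_sub_left_eq_self
      (fun u => indB d (1 + ‖x - y‖) u - indB d (1 - ‖x - y‖) u) volume x]
  refine norm_integral_le_of_norm_le
    (((integrable_indB _).sub (integrable_indB _)).comp_sub_left x)
    (Filter.Eventually.of_forall fun u => ?_)
  rw [← mul_sub, norm_mul, Real.norm_of_nonneg (indB_nonneg _ _), Real.norm_eq_abs]
  have := abs_indB_sub_le (x - u) (y - u)
  rw [sub_sub_sub_cancel_right] at this
  exact (mul_le_of_le_one_left (abs_nonneg _) (indB_le_one _ _)).trans this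

/-- For `‖x - y‖ ≤ 1` the difference is at most a normalized shell volume, where the chord bound
contributes `2 ^ d - 1` and Bernoulli's inequality `d`. Otherwise the trivial bound `1` is enough.
-/
lemma abs_ballOverlap_sub_le (x y : E d) :
    |ballOverlap d x - ballOverlap d y| ≤ (d + 2 ^ d) * ‖x - y‖ := by
  have hv := volB_one_pos (d := d)
  have h2 : (1 : ℝ) ≤ 2 ^ d := one_le_pow₀ (by norm_num)
  have hd0 : (0 : ℝ) ≤ d := Nat.cast_nonneg d
  rcases le_or_gt ‖x - y‖ 1 with h | h
  · rw [ballOverlap, ballOverlap, ← sub_div, abs_div, abs_of_pos hv, div_le_iff₀ hv]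
    refine (abs_ballConv_sub_le x y).trans ?_
    have h0 := norm_nonneg (x - y)
    rw [volB_eq (by linarith), volB_eq (t := 1 - ‖x - y‖) (by linarith), ← sub_mul]
    refine mul_le_mul_of_nonneg_right ?_ hv.le
    have e1 := one_add_pow_le h0 h d
    have e2 := one_add_mul_le_pow (a := -‖x - y‖) (by linarith) d
    rw [← sub_eq_add_neg] at e2
    nlinarith
  · have : |ballOverlap d x - ballOverlap d y| ≤ 1 := by
      rw [abs_le]
      constructor <;> linarith [ballOverlap_nonneg x, ballOverlap_nonneg y, ballOverlap_le_one x,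
        ballOverlap_le_one y]
    nlinarith

lemma continuous_ballOverlap : Continuous (ballOverlap d) := by
  have : LipschitzWith (d + 2 ^ d) (ballOverlap d) := by
    refine LipschitzWith.of_dist_le_mul fun x y => ?_
    rw [Real.dist_eq, dist_eq_norm]
    exact_mod_cast abs_ballOverlap_sub_le x y
  exact this.continuous

lemma hasCompactSupport_ballOverlap : HasCompactSupport (ballOverlap d) := by
  refine HasCompactSupport.intro (isCompact_closedBall (0 : E d) 2) fun x hx => ?_
  exact ballOverlap_eq_zero (by simpa using hx)

lemma integrable_ballOverlap : Integrable (ballOverlap d) :=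
  continuous_ballOverlap.integrable_of_hasCompactSupport hasCompactSupport_ballOverlap

/-- The Fourier transform of the indicator of the unit ball. -/
def ballFourier (d : ℕ) (k : E d) : ℝ := (𝓕 (fun x => (indB d 1 x : ℂ)) k).re

lemma indB_comp_isometry (A : E d ≃ₗᵢ[ℝ] E d) (r : ℝ) (x : E d) :
    indB d r (A x) = indB d r x := by
  rcases le_or_gt ‖x‖ r with h | h
  · rw [indB_of_le h, indB_of_le (by rwa [A.norm_map])]
  · rw [indB_of_lt h, indB_of_lt (by rwa [A.norm_map])]

lemma fourier_indB (k : E d) : 𝓕 (fun x => (indB d 1 x : ℂ)) k = (ballFourier d k : ℂ) := by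
  have h := fourier_conj_neg (fun x => (indB d 1 x : ℂ)) k
  have h1 : (fun w : E d => conj ((indB d 1 (-w) : ℝ) : ℂ)) = fun w => (indB d 1 w : ℂ) := by
    ext w
    rw [Complex.conj_ofReal]
    congr 1
    exact indB_comp_isometry (LinearIsometryEquiv.neg ℝ) 1 w
  rw [h1] at h
  exact (Complex.conj_eq_iff_re.1 h.symm).symm

lemma ballFourier_comp_isometry (A : E d ≃ₗᵢ[ℝ] E d) (k : E d) :
    ballFourier d (A k) = ballFourier d k := by
  rw [ballFourier, ballFourier, ← Real.fourier_comp_linearIsometry]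
  have : (fun x => (indB d 1 x : ℂ)) ∘ A = fun x => (indB d 1 x : ℂ) := by
    ext x
    simp [indB_comp_isometry]
  rw [this]

/-- The Fourier transform of `ballOverlap`. -/
def overlapFourier (d : ℕ) (k : E d) : ℝ := ballFourier d k ^ 2 / volB d 1

lemma overlapFourier_nonneg (k : E d) : 0 ≤ overlapFourier d k :=
  div_nonneg (sq_nonneg _) volB_one_pos.le

lemma fourier_ballOverlap (k : E d) :
    𝓕 (fun x => (ballOverlap d x : ℂ)) k = (overlapFourier d k : ℂ) := by
  have hi : Integrable fun x => (indB d 1 x : ℂ) := (integrable_indB 1).ofReal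
  have h := Real.fourier_mul_convolution_eq hi hi k
  rw [fourier_indB] at h
  have h1 : (fun x => (ballOverlap d x : ℂ)) = ((volB d 1 : ℝ) : ℂ)⁻¹ •
      ((fun x => (indB d 1 x : ℂ)) ⋆[ContinuousLinearMap.mul ℂ ℂ, volume]
        fun x => (indB d 1 x : ℂ)) := by
    ext x
    rw [Pi.smul_apply, convolution_def, ballOverlap, ballConv_apply, Complex.ofReal_div,
      ← integral_complex_ofReal, smul_eq_mul, div_eq_inv_mul]
    simp
  rw [h1, fourier_eq_chi]
  simp only [Pi.smul_apply, smul_eq_mul, mul_left_comm]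
  rw [integral_const_mul, ← fourier_eq_chi, h, overlapFourier]
  push_cast
  rw [div_eq_inv_mul, sq]

lemma continuous_overlapFourier : Continuous (overlapFourier d) := by
  have h : Continuous (𝓕 (fun x => (ballOverlap d x : ℂ))) :=
    continuous_fourier integrable_ballOverlap.ofReal
  have h2 := Complex.continuous_re.comp h
  refine h2.congr fun k => ?_
  simp [fourier_ballOverlap]

lemma overlapFourier_le (k : E d) : overlapFourier d k ≤ ∫ x, ballOverlap d x := by
  have h := norm_fourier_le (fun x => (ballOverlap d x : ℂ)) k
  rw [fourier_ballOverlap, Complex.norm_real, Real.norm_of_nonneg (overlapFourier_nonneg k)] at h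
  refine h.trans_eq (integral_congr_ae (Filter.Eventually.of_forall fun x => ?_))
  simp only
  rw [Complex.norm_real, Real.norm_of_nonneg (ballOverlap_nonneg x)]

/-- The reflection exchanging `k` and `l` preserves the ball, hence its Fourier transform. -/
lemma overlapFourier_eq_of_norm_eq {k l : E d} (h : ‖k‖ = ‖l‖) :
    overlapFourier d k = overlapFourier d l := by
  rw [overlapFourier, overlapFourier, ← ballFourier_comp_isometry
    ((Submodule.span ℝ {k - l})ᗮ.reflection) k, Submodule.reflection_sub h]

end

/-! ### Frequency decay of the overlap function -/

section

variable {d : ℕ}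

lemma integrable_exp_neg_mul_sq_norm {b : ℝ} (hb : 0 < b) :
    Integrable fun x : E d => Real.exp (-(b * ‖x‖ ^ 2)) := by
  have h := GaussianFourier.integrable_cexp_neg_mul_sq_norm_add (b := (b : ℂ)) (by simpa using hb)
    0 (0 : E d)
  refine h.norm.congr (Filter.Eventually.of_forall fun x => ?_)
  simp only [zero_mul, add_zero]
  rw [Complex.norm_exp]
  congr 1
  norm_cast
  simp

lemma integrable_norm_mul_gaussian :
    Integrable fun x : E d => Real.exp (-(Real.pi * ‖x‖ ^ 2)) * ‖x‖ := by
  refine (integrable_exp_neg_mul_sq_norm (b := Real.pi - 1)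
    (by linarith [Real.pi_gt_three])).mono' (Continuous.aestronglyMeasurable (by fun_prop))
    (Filter.Eventually.of_forall fun x => ?_)
  rw [Real.norm_of_nonneg (by positivity)]
  have h1 : ‖x‖ ≤ Real.exp (‖x‖ ^ 2) := by
    have := Real.add_one_le_exp (‖x‖ ^ 2)
    nlinarith [sq_nonneg (‖x‖ - 1)]
  calc Real.exp (-(Real.pi * ‖x‖ ^ 2)) * ‖x‖
      ≤ Real.exp (-(Real.pi * ‖x‖ ^ 2)) * Real.exp (‖x‖ ^ 2) := by gcongr
    _ = _ := by rw [← Real.exp_add]; ring_nf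

lemma integral_gaussian_overlapFourier {r : ℝ} (hr : 0 < r) :
    ∫ k, Real.exp (-(Real.pi * (r ^ 2)⁻¹ * ‖k‖ ^ 2)) * overlapFourier d k
      = ∫ w, Real.exp (-(Real.pi * ‖w‖ ^ 2)) * ballOverlap d (r⁻¹ • w) := by
  have h := integral_gaussian_mul_eq (A := fun x => (ballOverlap d x : ℂ))
    integrable_ballOverlap.ofReal (t := r ^ 2) (by positivity)
  simp_rw [fourier_ballOverlap, ← Complex.ofReal_mul] at h
  rw [integral_complex_ofReal, integral_complex_ofReal, ← Complex.ofReal_mul,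
    Complex.ofReal_inj] at h
  have hp : ((r ^ 2 : ℝ) ^ (-(d : ℝ) / 2)) = (r ^ d)⁻¹ := by
    rw [← Real.rpow_natCast, ← Real.rpow_mul hr.le, ← Real.rpow_natCast r d, ← Real.rpow_neg hr.le]
    congr 1
    push_cast
    ring
  rw [hp] at h
  have h2 := Measure.integral_comp_smul_of_nonneg (volume : Measure (E d))
    (fun w => Real.exp (-(Real.pi * ‖w‖ ^ 2)) * ballOverlap d (r⁻¹ • w)) r (hR := hr.le)
  simp only [smul_eq_mul, finrank_euclideanSpace, Fintype.card_fin, norm_smul,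
    Real.norm_of_nonneg hr.le, smul_smul, inv_mul_cancel₀ hr.ne', one_smul, mul_pow,
    ← mul_assoc] at h2
  rw [h] at h2
  exact mul_left_cancel₀ (by positivity) h2

lemma integrable_gaussian_overlapFourier {b : ℝ} (hb : 0 < b) :
    Integrable fun k => Real.exp (-(b * ‖k‖ ^ 2)) * overlapFourier d k := by
  refine ((integrable_exp_neg_mul_sq_norm hb).mul_const (∫ x, ballOverlap d x)).mono' ?_
    (Filter.Eventually.of_forall fun k => ?_)
  · have := continuous_overlapFourier (d := d)
    exact Continuous.aestronglyMeasurable (by fun_prop)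
  · rw [Real.norm_of_nonneg (mul_nonneg (Real.exp_pos _).le (overlapFourier_nonneg k))]
    exact mul_le_mul_of_nonneg_left (overlapFourier_le k) (Real.exp_pos _).le

lemma integrable_gaussian_mul_ballOverlap (r : ℝ) :
    Integrable fun w : E d => Real.exp (-(Real.pi * ‖w‖ ^ 2)) * ballOverlap d (r • w) := by
  refine (integrable_exp_neg_mul_sq_norm Real.pi_pos).mono' ?_
    (Filter.Eventually.of_forall fun k => ?_)
  · have := continuous_ballOverlap (d := d)
    exact Continuous.aestronglyMeasurable (by fun_prop)
  · rw [Real.norm_of_nonneg (mul_nonneg (Real.exp_pos _).le (ballOverlap_nonneg _))]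
    exact mul_le_of_le_one_right (Real.exp_pos _).le (ballOverlap_le_one _)

/-- With `v = (u / r) ^ 2`, which lies in `[1 / 4, 9 / 4]`, the right side is `exp (-π v) (1 - exp
(-3 π v))`. -/
lemma gaussian_difference_lower_bound {r u : ℝ} (hr : 0 < r) (h1 : r / 2 ≤ u)
    (h2 : u ≤ 3 * r / 2) : Real.exp (-9 * Real.pi / 4) * (1 - Real.exp (-3 * Real.pi / 4))
      ≤ Real.exp (-(Real.pi * (r ^ 2)⁻¹ * u ^ 2))
        - Real.exp (-(Real.pi * ((r / 2) ^ 2)⁻¹ * u ^ 2)) := by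
  have hpi := Real.pi_pos
  set v := (r ^ 2)⁻¹ * u ^ 2 with hv
  have hv1 : 1 / 4 ≤ v := by
    rw [hv, inv_mul_eq_div, le_div_iff₀ (by positivity)]
    nlinarith
  have hv2 : v ≤ 9 / 4 := by
    rw [hv, inv_mul_eq_div, div_le_iff₀ (by positivity)]
    nlinarith
  have e1 : -(Real.pi * (r ^ 2)⁻¹ * u ^ 2) = -(Real.pi * v) := by rw [hv]; ring
  have e2 : -(Real.pi * ((r / 2) ^ 2)⁻¹ * u ^ 2) = -(Real.pi * v) + -(3 * Real.pi * v) := by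
    rw [hv]; field_simp; ring
  rw [e1, e2, Real.exp_add]
  have f1 : Real.exp (-9 * Real.pi / 4) ≤ Real.exp (-(Real.pi * v)) :=
    Real.exp_le_exp.2 (by nlinarith)
  have f2 : Real.exp (-(3 * Real.pi * v)) ≤ Real.exp (-3 * Real.pi / 4) :=
    Real.exp_le_exp.2 (by nlinarith)
  have f3 : Real.exp (-3 * Real.pi / 4) ≤ 1 := Real.exp_le_one_iff.2 (by linarith)
  nlinarith [Real.exp_pos (-9 * Real.pi / 4), Real.exp_pos (-(Real.pi * v))]

/-- The energy of the unit ball in the frequency annulus of radius `r` is `O(1 / r)`. -/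
lemma exists_annulus_bound (d : ℕ) : ∃ C : ℝ, 0 ≤ C ∧ ∀ r : ℝ, 0 < r →
    ∫ k, (Icc (r / 2) (3 * r / 2)).indicator (fun _ => overlapFourier d k) ‖k‖ ≤ C / r := by
  set c₀ : ℝ := Real.exp (-9 * Real.pi / 4) * (1 - Real.exp (-3 * Real.pi / 4)) with hc₀
  have hc : 0 < c₀ := by
    have : Real.exp (-3 * Real.pi / 4) < 1 := Real.exp_lt_one_iff.2 (by linarith [Real.pi_pos])
    have := Real.exp_pos (-9 * Real.pi / 4)
    rw [hc₀]
    exact mul_pos this (by linarith)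
  set M : ℝ := ∫ x : E d, Real.exp (-(Real.pi * ‖x‖ ^ 2)) * ‖x‖ with hM
  have hM0 : 0 ≤ M := integral_nonneg fun _ => by positivity
  refine ⟨c₀⁻¹ * ((d + 2 ^ d) * M), by positivity, fun r hr => ?_⟩
  have hpi := Real.pi_pos
  have i1 := integrable_gaussian_overlapFourier (d := d) (b := Real.pi * (r ^ 2)⁻¹) (by positivity)
  have i2 := integrable_gaussian_overlapFourier (d := d) (b := Real.pi * ((r / 2) ^ 2)⁻¹)
    (by positivity)
  -- In physical space the two Gaussians sample the overlap function at `w / r` and `2 w / r`; the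
  -- Lipschitz bound gains `‖w‖ / r`.
  have hupper : ∫ k, (Real.exp (-(Real.pi * (r ^ 2)⁻¹ * ‖k‖ ^ 2)) * overlapFourier d k
      - Real.exp (-(Real.pi * ((r / 2) ^ 2)⁻¹ * ‖k‖ ^ 2)) * overlapFourier d k)
      ≤ (d + 2 ^ d) * M / r := by
    rw [integral_sub i1 i2, integral_gaussian_overlapFourier hr,
      integral_gaussian_overlapFourier (half_pos hr),
      ← integral_sub (integrable_gaussian_mul_ballOverlap _)
        (integrable_gaussian_mul_ballOverlap _)]
    have : (d + 2 ^ d) * M / r = ∫ x : E d, (d + 2 ^ d) / r *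
        (Real.exp (-(Real.pi * ‖x‖ ^ 2)) * ‖x‖) := by
      rw [integral_const_mul]; ring
    rw [this]
    refine integral_mono ((integrable_gaussian_mul_ballOverlap _).sub
      (integrable_gaussian_mul_ballOverlap _)) (integrable_norm_mul_gaussian.const_mul _)
      fun w => ?_
    simp only
    rw [← mul_sub]
    have h1 := (le_abs_self _).trans (abs_ballOverlap_sub_le (r⁻¹ • w) ((r / 2)⁻¹ • w))
    have h2 : ‖r⁻¹ • w - (r / 2)⁻¹ • w‖ = ‖w‖ / r := by
      rw [← sub_smul, norm_smul]
      have : r⁻¹ - (r / 2)⁻¹ = -r⁻¹ := by field_simp; norm_num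
      rw [this, norm_neg, norm_inv, Real.norm_of_nonneg hr.le, div_eq_inv_mul]
    rw [h2] at h1
    calc _ ≤ Real.exp (-(Real.pi * ‖w‖ ^ 2)) * ((d + 2 ^ d) * (‖w‖ / r)) := by gcongr
      _ = _ := by ring
  -- The Gaussian difference is nonnegative everywhere and at least `c₀` on the annulus.
  have hlower : c₀ * ∫ k, (Icc (r / 2) (3 * r / 2)).indicator (fun _ => overlapFourier d k) ‖k‖
      ≤ ∫ k, (Real.exp (-(Real.pi * (r ^ 2)⁻¹ * ‖k‖ ^ 2)) * overlapFourier d k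
      - Real.exp (-(Real.pi * ((r / 2) ^ 2)⁻¹ * ‖k‖ ^ 2)) * overlapFourier d k) := by
    rw [← integral_const_mul]
    refine integral_mono_of_nonneg (Filter.Eventually.of_forall fun k => ?_) (i1.sub i2)
      (Filter.Eventually.of_forall fun k => ?_)
    · exact mul_nonneg hc.le (indicator_nonneg (fun _ _ => overlapFourier_nonneg k) _)
    · simp only
      rw [← sub_mul]
      by_cases hk : ‖k‖ ∈ Icc (r / 2) (3 * r / 2)
      · rw [indicator_of_mem hk]
        exact mul_le_mul_of_nonneg_right (gaussian_difference_lower_bound hr hk.1 hk.2)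
          (overlapFourier_nonneg k)
      · rw [indicator_of_notMem hk, mul_zero]
        refine mul_nonneg (sub_nonneg.2 (Real.exp_le_exp.2 (neg_le_neg ?_)))
          (overlapFourier_nonneg k)
        have : r / 2 ≤ r := by linarith
        gcongr
  calc _ = c₀⁻¹ * (c₀ *
        ∫ k, (Icc (r / 2) (3 * r / 2)).indicator (fun _ => overlapFourier d k) ‖k‖) := by
        rw [inv_mul_cancel_left₀ hc.ne']
    _ ≤ c₀⁻¹ * ((d + 2 ^ d) * M / r) := by
        gcongr
        exact hlower.trans hupper
    _ = _ := by ring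

/-- A radial average of the energy of the unit ball decays like `‖k‖ ^ (-(d + 1))`. -/
lemma exists_radial_average_bound (hd : 1 ≤ d) : ∃ C : ℝ, 0 ≤ C ∧ ∀ k : E d, k ≠ 0 →
    ∫ t in (1 / 2 : ℝ)..(3 / 2), overlapFourier d (t • k) ≤ C / ‖k‖ ^ (d + 1) := by
  obtain ⟨C, hC0, hC⟩ := exists_annulus_bound d
  have : Nonempty (Fin d) := ⟨⟨0, hd⟩⟩
  -- A unit vector, used to read off the radial profile `g` of the spectrum.
  set e : E d := EuclideanSpace.single ⟨0, hd⟩ 1 with he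
  have hen : ‖e‖ = 1 := by simp [he]
  set g : ℝ → ℝ := fun u => overlapFourier d (u • e) with hg
  have hgc : Continuous g := continuous_overlapFourier.comp (by fun_prop)
  have hg0 : ∀ u, 0 ≤ g u := fun u => overlapFourier_nonneg _
  have hgk : ∀ k : E d, overlapFourier d k = g ‖k‖ := fun k =>
    overlapFourier_eq_of_norm_eq (by rw [norm_smul, hen, mul_one, norm_norm])
  have hv : 0 < volume.real (Metric.ball (0 : E d) 1) :=
    ENNReal.toReal_pos (Metric.measure_ball_pos _ _ one_pos).ne' measure_ball_lt_top.ne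
  set v := volume.real (Metric.ball (0 : E d) 1) with hvd
  have hd0 : (0 : ℝ) < d := by exact_mod_cast hd
  refine ⟨C * 2 ^ (d - 1) / (d * v), by positivity, fun k hk => ?_⟩
  set r := ‖k‖ with hr
  have hr0 : 0 < r := norm_pos_iff.2 hk
  have h1 : ∫ t in (1 / 2 : ℝ)..(3 / 2), overlapFourier d (t • k)
      = r⁻¹ * ∫ u in Icc (r / 2) (3 * r / 2), g u := by
    have e1 : ∀ t ∈ uIcc (1 / 2 : ℝ) (3 / 2), overlapFourier d (t • k) = g (t * r) := by
      intro t ht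
      rw [uIcc_of_le (by norm_num)] at ht
      rw [hgk, norm_smul, Real.norm_of_nonneg (by linarith [ht.1])]
    rw [intervalIntegral.integral_congr e1, intervalIntegral.integral_comp_mul_right _ hr0.ne',
      smul_eq_mul, intervalIntegral.integral_of_le (by nlinarith), integral_Icc_eq_integral_Ioc]
    congr 4 <;> ring
  have h2 := hC r hr0
  have h3 : ∫ k : E d, (Icc (r / 2) (3 * r / 2)).indicator (fun _ => overlapFourier d k) ‖k‖
      = ∫ k : E d, (Icc (r / 2) (3 * r / 2)).indicator g ‖k‖ := by
    refine integral_congr_ae (Filter.Eventually.of_forall fun k => ?_)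
    simp only [indicator]
    split_ifs
    · exact hgk k
    · rfl
  rw [h3, integral_fun_norm_addHaar] at h2
  simp only [finrank_euclideanSpace, Fintype.card_fin, smul_eq_mul, nsmul_eq_mul] at h2
  -- In polar coordinates the Jacobian `y ^ (d - 1)` is at least `(r / 2) ^ (d - 1)` on the annulus.
  -- Removing it, together with the `r⁻¹` from `u = t r`, turns `C / r` into order `r ^ (-(d + 1))`.
  have h4 : (r / 2) ^ (d - 1) * ∫ u in Icc (r / 2) (3 * r / 2), g u
      ≤ ∫ y in Ioi (0 : ℝ), y ^ (d - 1) * (Icc (r / 2) (3 * r / 2)).indicator g y := by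
    have e2 : ∫ y in Ioi (0 : ℝ), y ^ (d - 1) * (Icc (r / 2) (3 * r / 2)).indicator g y
        = ∫ y in Icc (r / 2) (3 * r / 2), y ^ (d - 1) * g y := by
      have : (fun y : ℝ => y ^ (d - 1) * (Icc (r / 2) (3 * r / 2)).indicator g y)
          = (Icc (r / 2) (3 * r / 2)).indicator fun y => y ^ (d - 1) * g y := by
        ext y
        simp only [indicator]
        split_ifs <;> simp
      rw [this, setIntegral_indicator measurableSet_Icc, inter_eq_self_of_subset_right]
      intro y hy
      exact lt_of_lt_of_le (by positivity) hy.1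
    rw [e2, ← integral_const_mul]
    refine setIntegral_mono_on ?_ ?_ measurableSet_Icc fun y hy => ?_
    · exact (continuous_const.mul hgc).continuousOn.integrableOn_compact isCompact_Icc
    · exact ((continuous_pow _).mul hgc).continuousOn.integrableOn_compact isCompact_Icc
    · have := hy.1
      exact mul_le_mul_of_nonneg_right (by gcongr) (hg0 y)
  have h5 : (d * v) * ((r / 2) ^ (d - 1) * ∫ u in Icc (r / 2) (3 * r / 2), g u) ≤ C / r := by
    refine le_trans ?_ h2
    rw [mul_assoc]
    gcongr
  rw [h1, le_div_iff₀ (by positivity), le_div_iff₀ (by positivity)]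
  rw [le_div_iff₀ hr0] at h5
  have hpow : r ^ (d + 1) = 2 ^ (d - 1) * (r / 2) ^ (d - 1) * r * r := by
    rw [← mul_pow, mul_div_cancel₀ _ (two_ne_zero), ← pow_succ, ← pow_succ]
    congr 1
    omega
  rw [hpow]
  calc _ = 2 ^ (d - 1) *
        (d * v * ((r / 2) ^ (d - 1) * ∫ u in Icc (r / 2) (3 * r / 2), g u) * r) := by
        field_simp
    _ ≤ 2 ^ (d - 1) * C := by gcongr
    _ = _ := mul_comm _ _

end

/-! ### The mollified overlap function -/

section

variable {d : ℕ} {η : ℝ} {ρ : ℝ → ℝ}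

lemma IsProfile.half_le (hη' : η ≤ 1 / 2) {t : ℝ} (ht : t ∈ Ioc (1 - η) (1 + η)) :
    1 / 2 ≤ t := by
  linarith [ht.1]

lemma IsProfile.intervalIntegral_eq_one (hρ : IsProfile η ρ) (hη : 0 < η) :
    ∫ t in (1 - η)..(1 + η), ρ t = 1 := by
  rw [intervalIntegral.integral_of_le (by linarith), ← integral_Icc_eq_integral_Ioc,
    setIntegral_eq_integral_of_forall_compl_eq_zero, hρ.integral_eq_one]
  intro t ht
  exact image_eq_zero_of_notMem_tsupport fun h => ht (hρ.support_subset h)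

lemma IsProfile.integrableOn (hρ : IsProfile η ρ) :
    IntegrableOn ρ (Ioc (1 - η) (1 + η)) :=
  (hρ.smooth.continuous.integrableOn_Icc).mono_set Ioc_subset_Icc_self

lemma Q₀_eq (hη : 0 < η) (hη' : η ≤ 1 / 2) (x : E d) :
    Q₀ d η ρ x = ∫ t in Ioc (1 - η) (1 + η), ballOverlap d (t⁻¹ • x) * ρ t := by
  rw [Q₀, intervalIntegral.integral_of_le (by linarith)]
  refine setIntegral_congr_fun measurableSet_Ioc fun t ht => ?_
  rw [ballConv_div_volB (by linarith [IsProfile.half_le hη' ht])]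

lemma aestronglyMeasurable_ballOverlap_profile (hρ : IsProfile η ρ) (x : E d) (μ : Measure ℝ) :
    AEStronglyMeasurable (fun t => ballOverlap d (t⁻¹ • x) * ρ t) μ := by
  have h1 := continuous_ballOverlap (d := d).measurable
  have h2 := hρ.smooth.continuous.measurable
  exact Measurable.aestronglyMeasurable (by fun_prop)

lemma norm_ballOverlap_mul_le (hρ : IsProfile η ρ) (x : E d) (t : ℝ) :
    ‖ballOverlap d x * ρ t‖ ≤ ρ t := by
  rw [Real.norm_of_nonneg (mul_nonneg (ballOverlap_nonneg _) (hρ.nonneg t))]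
  exact mul_le_of_le_one_left (hρ.nonneg t) (ballOverlap_le_one _)

lemma continuous_Q₀ (hη : 0 < η) (hη' : η ≤ 1 / 2) (hρ : IsProfile η ρ) :
    Continuous (Q₀ d η ρ) := by
  rw [show Q₀ d η ρ = fun x => ∫ t in Ioc (1 - η) (1 + η), ballOverlap d (t⁻¹ • x) * ρ t from
    funext fun x => Q₀_eq hη hη' x]
  refine continuous_of_dominated
    (fun x => aestronglyMeasurable_ballOverlap_profile hρ x _)
    (fun x => Filter.Eventually.of_forall fun t => norm_ballOverlap_mul_le hρ _ t)
    hρ.integrableOn (Filter.Eventually.of_forall fun t => ?_)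
  have h1 := continuous_ballOverlap (d := d)
  fun_prop

lemma Q₀_nonneg (hη : 0 < η) (hη' : η ≤ 1 / 2) (hρ : IsProfile η ρ) (x : E d) :
    0 ≤ Q₀ d η ρ x := by
  rw [Q₀_eq hη hη']
  exact integral_nonneg fun t => mul_nonneg (ballOverlap_nonneg _) (hρ.nonneg t)

lemma Q₀_zero (hη : 0 < η) (hη' : η ≤ 1 / 2) (hρ : IsProfile η ρ) : Q₀ d η ρ 0 = 1 := by
  have h := hρ.intervalIntegral_eq_one hη
  rw [intervalIntegral.integral_of_le (by linarith)] at h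
  simpa [Q₀_eq hη hη', ballOverlap_zero] using h

/-- Radii satisfy `t ≤ 3 / 2` and the overlap vanishes beyond distance `2`, so everything is
supported in radius `3`. -/
lemma ballOverlap_inv_smul_eq_zero (hη' : η ≤ 1 / 2) {x : E d} (hx : 3 < ‖x‖) {t : ℝ}
    (ht : t ∈ Ioc (1 - η) (1 + η)) : ballOverlap d (t⁻¹ • x) = 0 := by
  have h1 := IsProfile.half_le hη' ht
  have h2 := ht.2
  refine ballOverlap_eq_zero ?_
  rw [norm_smul, norm_inv, Real.norm_of_nonneg (by linarith), ← div_eq_inv_mul,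
    lt_div_iff₀ (by linarith)]
  linarith

lemma hasCompactSupport_Q₀ (hη : 0 < η) (hη' : η ≤ 1 / 2) :
    HasCompactSupport (Q₀ d η ρ) := by
  refine HasCompactSupport.intro (isCompact_closedBall (0 : E d) 3) fun x hx => ?_
  rw [Q₀_eq hη hη']
  refine setIntegral_eq_zero_of_forall_eq_zero fun t ht => ?_
  rw [ballOverlap_inv_smul_eq_zero hη' (by simpa using hx) ht, zero_mul]

lemma integrable_Q₀ (hη : 0 < η) (hη' : η ≤ 1 / 2) (hρ : IsProfile η ρ) :
    Integrable (Q₀ d η ρ) :=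
  (continuous_Q₀ hη hη' hρ).integrable_of_hasCompactSupport (hasCompactSupport_Q₀ hη hη')

lemma integral_Q₀_pos (hη : 0 < η) (hη' : η ≤ 1 / 2) (hρ : IsProfile η ρ) :
    0 < ∫ x, Q₀ d η ρ x := by
  have h0 : Q₀ d η ρ 0 ≠ 0 := by rw [Q₀_zero hη hη' hρ]; exact one_ne_zero
  exact (continuous_Q₀ hη hη' hρ).integral_pos_of_hasCompactSupport_nonneg_nonzero
    (hasCompactSupport_Q₀ hη hη') (Q₀_nonneg hη hη' hρ) h0

/-- The Fourier transform of `Q₀`. -/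
def Q₀Fourier (d : ℕ) (η : ℝ) (ρ : ℝ → ℝ) (k : E d) : ℝ :=
  ∫ t in Ioc (1 - η) (1 + η), ρ t * (t ^ d * overlapFourier d (t • k))

lemma Q₀Fourier_nonneg (hη' : η ≤ 1 / 2) (hρ : IsProfile η ρ) (k : E d) :
    0 ≤ Q₀Fourier d η ρ k := by
  refine setIntegral_nonneg measurableSet_Ioc fun t ht => ?_
  have := IsProfile.half_le hη' ht
  exact mul_nonneg (hρ.nonneg t) (mul_nonneg (by positivity) (overlapFourier_nonneg _))

lemma fourier_ballOverlap_inv_smul {t : ℝ} (ht : 0 < t) (k : E d) :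
    ∫ x, chi (-k) x * (ballOverlap d (t⁻¹ • x) : ℂ)
      = ((t ^ d * overlapFourier d (t • k) : ℝ) : ℂ) := by
  have h := Measure.integral_comp_inv_smul_of_nonneg (volume : Measure (E d))
    (fun x => chi (-k) (t • x) * (ballOverlap d x : ℂ)) ht.le
  simp only [smul_smul, mul_inv_cancel₀ ht.ne', one_smul, finrank_euclideanSpace,
    Fintype.card_fin, chi_smul, smul_neg] at h
  rw [h, ← fourier_eq_chi (fun x => (ballOverlap d x : ℂ)), fourier_ballOverlap]
  simp

lemma fourier_Q₀ (hη : 0 < η) (hη' : η ≤ 1 / 2) (hρ : IsProfile η ρ) (k : E d) :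
    𝓕 (fun x => (Q₀ d η ρ x : ℂ)) k = (Q₀Fourier d η ρ k : ℂ) := by
  have hb : Integrable ((Metric.closedBall (0 : E d) 3).indicator fun _ => (1 : ℝ)) :=
    (integrable_indicator_iff measurableSet_closedBall).2
      (integrableOn_const measure_closedBall_lt_top.ne)
  have hi : Integrable (fun p : E d × ℝ =>
      chi (-k) p.1 * ((ballOverlap d (p.2⁻¹ • p.1) * ρ p.2 : ℝ) : ℂ))
      (volume.prod (volume.restrict (Ioc (1 - η) (1 + η)))) := by
    refine (hb.mul_prod hρ.integrableOn).mono' ?_ ?_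
    · have h1 := continuous_ballOverlap (d := d).measurable
      have h2 := hρ.smooth.continuous.measurable
      have h3 : Measurable fun p : E d × ℝ => chi (-k) p.1 :=
        Continuous.measurable (by fun_prop)
      exact Measurable.aestronglyMeasurable (by fun_prop)
    · have hae : ∀ᵐ p : E d × ℝ ∂(volume.prod (volume.restrict (Ioc (1 - η) (1 + η)))),
          p.2 ∈ Ioc (1 - η) (1 + η) :=
        Measure.quasiMeasurePreserving_snd.ae (ae_restrict_mem measurableSet_Ioc)
      filter_upwards [hae] with p hp
      rw [norm_mul, norm_chi, one_mul, Complex.norm_real]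
      by_cases hx : p.1 ∈ Metric.closedBall (0 : E d) 3
      · rw [indicator_of_mem hx, one_mul]
        exact norm_ballOverlap_mul_le hρ _ _
      · rw [ballOverlap_inv_smul_eq_zero hη' (by simpa using hx) hp, indicator_of_notMem hx]
        simp
  rw [fourier_eq_chi]
  calc _ = ∫ x, ∫ t in Ioc (1 - η) (1 + η),
        chi (-k) x * ((ballOverlap d (t⁻¹ • x) * ρ t : ℝ) : ℂ) := by
        refine integral_congr_ae (Filter.Eventually.of_forall fun x => ?_)
        simp only
        rw [Q₀_eq hη hη', integral_const_mul, integral_complex_ofReal]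
    _ = ∫ t in Ioc (1 - η) (1 + η), ∫ x,
        chi (-k) x * ((ballOverlap d (t⁻¹ • x) * ρ t : ℝ) : ℂ) := integral_integral_swap hi
    _ = ∫ t in Ioc (1 - η) (1 + η), ((ρ t * (t ^ d * overlapFourier d (t • k)) : ℝ) : ℂ) := by
        refine setIntegral_congr_fun measurableSet_Ioc fun t ht => ?_
        have ht0 : 0 < t := by linarith [IsProfile.half_le hη' ht]
        simp only [Complex.ofReal_mul, ← mul_assoc]
        rw [integral_mul_const, fourier_ballOverlap_inv_smul ht0]
        push_cast
        ring
    _ = _ := by rw [integral_complex_ofReal, Q₀Fourier]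

lemma continuous_Q₀Fourier (hη : 0 < η) (hη' : η ≤ 1 / 2) (hρ : IsProfile η ρ) :
    Continuous (Q₀Fourier d η ρ) := by
  have h : Continuous (𝓕 (fun x => (Q₀ d η ρ x : ℂ))) :=
    continuous_fourier (integrable_Q₀ hη hη' hρ).ofReal
  refine (Complex.continuous_re.comp h).congr fun k => ?_
  simp [fourier_Q₀ hη hη' hρ]

lemma Q₀Fourier_le (hη : 0 < η) (hη' : η ≤ 1 / 2) (hρ : IsProfile η ρ) (k : E d) :
    Q₀Fourier d η ρ k ≤ ∫ x, Q₀ d η ρ x := by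
  have h := norm_fourier_le (fun x => (Q₀ d η ρ x : ℂ)) k
  rw [fourier_Q₀ hη hη' hρ, Complex.norm_real, Real.norm_of_nonneg (Q₀Fourier_nonneg hη' hρ k)]
    at h
  refine h.trans_eq (integral_congr_ae (Filter.Eventually.of_forall fun x => ?_))
  simp only
  rw [Complex.norm_real, Real.norm_of_nonneg (Q₀_nonneg hη hη' hρ x)]

/-- The profile is bounded, `t ^ d ≤ (3 / 2) ^ d`, and the averaging interval lies in `[1 / 2, 3 /
2]`; the radial average bound then applies. -/
lemma exists_Q₀Fourier_decay (hd : 1 ≤ d) (hη' : η ≤ 1 / 2) (hρ : IsProfile η ρ) :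
    ∃ C : ℝ, 0 ≤ C ∧ ∀ k : E d, k ≠ 0 → Q₀Fourier d η ρ k ≤ C / ‖k‖ ^ (d + 1) := by
  obtain ⟨C, hC0, hC⟩ := exists_radial_average_bound hd
  obtain ⟨b, hb⟩ := hρ.smooth.continuous.bounded_above_of_compact_support
    (isCompact_Icc.of_isClosed_subset (isClosed_tsupport ρ) hρ.support_subset)
  have hb0 : 0 ≤ b := (norm_nonneg _).trans (hb 0)
  refine ⟨b * (3 / 2) ^ d * C, by positivity, fun k hk => ?_⟩
  have hcont : Continuous fun t : ℝ => overlapFourier d (t • k) :=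
    continuous_overlapFourier.comp (by fun_prop)
  have hio : IntegrableOn (fun t : ℝ => b * (3 / 2) ^ d * overlapFourier d (t • k))
      (Ioc (1 / 2) (3 / 2)) :=
    ((continuous_const.mul hcont).integrableOn_Icc).mono_set Ioc_subset_Icc_self
  have hsub : Ioc (1 - η) (1 + η) ⊆ Ioc (1 / 2 : ℝ) (3 / 2) :=
    Ioc_subset_Ioc (by linarith) (by linarith)
  calc Q₀Fourier d η ρ k
      ≤ ∫ t in Ioc (1 - η) (1 + η), b * (3 / 2) ^ d * overlapFourier d (t • k) := by
        refine setIntegral_mono_on ?_ (hio.mono_set hsub) measurableSet_Ioc fun t ht => ?_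
        · have := hρ.smooth.continuous
          exact (Continuous.integrableOn_Icc (by fun_prop)).mono_set Ioc_subset_Icc_self
        · have h1 := IsProfile.half_le hη' ht
          have h2 : t ≤ 3 / 2 := by linarith [ht.2]
          have h3 : ρ t ≤ b := (le_abs_self _).trans (hb t)
          rw [mul_assoc]
          have h4 := overlapFourier_nonneg (t • k)
          have h5 := hρ.nonneg t
          gcongr
    _ ≤ ∫ t in Ioc (1 / 2 : ℝ) (3 / 2), b * (3 / 2) ^ d * overlapFourier d (t • k) := by
        refine setIntegral_mono_set hio (Filter.Eventually.of_forall fun t => ?_)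
          hsub.eventuallyLE
        have h4 := overlapFourier_nonneg (t • k)
        simp only [Pi.zero_apply]
        positivity
    _ = b * (3 / 2) ^ d * ∫ t in (1 / 2 : ℝ)..(3 / 2), overlapFourier d (t • k) := by
        rw [integral_const_mul, intervalIntegral.integral_of_le (by norm_num)]
    _ ≤ b * (3 / 2) ^ d * (C / ‖k‖ ^ (d + 1)) := by gcongr; exact hC k hk
    _ = _ := by ring

/-- The Fourier transform of `Q₀` decays like `(1 + ‖k‖) ^ (-(d + 1))`. -/
lemma exists_Q₀Fourier_bound (hd : 1 ≤ d) (hη : 0 < η) (hη' : η ≤ 1 / 2) (hρ : IsProfile η ρ) :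
    ∃ C : ℝ, 0 ≤ C ∧ ∀ k : E d, Q₀Fourier d η ρ k ≤ C * (1 + ‖k‖) ^ (-((d : ℝ) + 1)) := by
  obtain ⟨C, hC0, hC⟩ := exists_Q₀Fourier_decay hd hη' hρ
  have hI := (integral_Q₀_pos (d := d) hη hη' hρ).le
  refine ⟨2 ^ (d + 1) * (C + ∫ x, Q₀ d η ρ x), by positivity, fun k => ?_⟩
  have h0 : (0 : ℝ) < 1 + ‖k‖ := by positivity
  have e : (1 + ‖k‖) ^ (-((d : ℝ) + 1)) = ((1 + ‖k‖) ^ (d + 1))⁻¹ := by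
    rw [Real.rpow_neg h0.le]
    norm_cast
  rw [e, ← div_eq_mul_inv, le_div_iff₀ (by positivity)]
  rcases le_or_gt ‖k‖ 1 with h | h
  · have h1 : (1 + ‖k‖) ^ (d + 1) ≤ 2 ^ (d + 1) := by gcongr; linarith
    calc _ ≤ (∫ x, Q₀ d η ρ x) * 2 ^ (d + 1) := by
          gcongr
          exact Q₀Fourier_le hη hη' hρ k
      _ ≤ _ := by nlinarith [pow_pos (two_pos (α := ℝ)) (d + 1)]
  · have hk : k ≠ 0 := by rintro rfl; simp at h; linarith
    have h1 : (1 + ‖k‖) ^ (d + 1) ≤ 2 ^ (d + 1) * ‖k‖ ^ (d + 1) := by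
      rw [← mul_pow]; gcongr; linarith
    have h2 := hC k hk
    rw [le_div_iff₀ (by positivity)] at h2
    have h3 := Q₀Fourier_nonneg hη' hρ k
    calc _ ≤ Q₀Fourier d η ρ k * (2 ^ (d + 1) * ‖k‖ ^ (d + 1)) := by gcongr
      _ = 2 ^ (d + 1) * (Q₀Fourier d η ρ k * ‖k‖ ^ (d + 1)) := by ring
      _ ≤ 2 ^ (d + 1) * (C + ∫ x, Q₀ d η ρ x) := by gcongr; linarith

lemma integrable_Q₀Fourier (hd : 1 ≤ d) (hη : 0 < η) (hη' : η ≤ 1 / 2) (hρ : IsProfile η ρ) :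
    Integrable (Q₀Fourier d η ρ) := by
  obtain ⟨C, -, hC⟩ := exists_Q₀Fourier_bound hd hη hη' hρ
  refine ((integrable_one_add_norm (E := E d) (r := (d : ℝ) + 1) (by simp)).const_mul C).mono'
    (continuous_Q₀Fourier hη hη' hρ).aestronglyMeasurable (Filter.Eventually.of_forall fun k => ?_)
  rw [Real.norm_of_nonneg (Q₀Fourier_nonneg hη' hρ k)]
  exact hC k

/-- Decay of order `d + 1` guarantees moments of order below one. The half moment fixes the rate in
`exists_potential_asymptotic`. -/
lemma integrable_sqrt_norm_mul_Q₀Fourier (hd : 1 ≤ d) (hη : 0 < η) (hη' : η ≤ 1 / 2)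
    (hρ : IsProfile η ρ) : Integrable fun k => √‖k‖ * Q₀Fourier d η ρ k := by
  obtain ⟨C, hC0, hC⟩ := exists_Q₀Fourier_bound hd hη hη' hρ
  refine ((integrable_one_add_norm (E := E d) (r := (d : ℝ) + 1 / 2)
    (by simp)).const_mul C).mono' ?_ (Filter.Eventually.of_forall fun k => ?_)
  · have := continuous_Q₀Fourier (d := d) hη hη' hρ
    exact Continuous.aestronglyMeasurable (by fun_prop)
  · have h3 := Q₀Fourier_nonneg hη' hρ k
    rw [Real.norm_of_nonneg (by positivity)]
    have h0 : (0 : ℝ) < 1 + ‖k‖ := by positivity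
    calc √‖k‖ * Q₀Fourier d η ρ k
        ≤ √(1 + ‖k‖) * (C * (1 + ‖k‖) ^ (-((d : ℝ) + 1))) := by
          gcongr
          · linarith
          · exact hC k
      _ = C * ((1 + ‖k‖) ^ (1 / 2 : ℝ) * (1 + ‖k‖) ^ (-((d : ℝ) + 1))) := by
          rw [Real.sqrt_eq_rpow]; ring
      _ = _ := by
          rw [← Real.rpow_add h0]
          congr 2
          ring

lemma Q₀_eq_integral_chi (hd : 1 ≤ d) (hη : 0 < η) (hη' : η ≤ 1 / 2) (hρ : IsProfile η ρ)
    (z : E d) : (Q₀ d η ρ z : ℂ) = ∫ l, chi l z * (Q₀Fourier d η ρ l : ℂ) := by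
  have hF : 𝓕 (fun x => (Q₀ d η ρ x : ℂ)) = fun k => (Q₀Fourier d η ρ k : ℂ) :=
    funext (fourier_Q₀ hη hη' hρ)
  have hc : Continuous fun x => (Q₀ d η ρ x : ℂ) :=
    Complex.continuous_ofReal.comp (continuous_Q₀ hη hη' hρ)
  have h := congrFun (hc.fourierInv_fourier_eq (integrable_Q₀ hη hη' hρ).ofReal
    (by rw [hF]; exact (integrable_Q₀Fourier hd hη hη' hρ).ofReal)) z
  rw [hF, fourierInv_eq_chi] at h
  exact h.symm

/-- Fourier inversion at the origin, where `Q₀` equals one. -/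
lemma integral_Q₀Fourier (hd : 1 ≤ d) (hη : 0 < η) (hη' : η ≤ 1 / 2) (hρ : IsProfile η ρ) :
    ∫ l, Q₀Fourier d η ρ l = 1 := by
  have h := Q₀_eq_integral_chi hd hη hη' hρ (0 : E d)
  have h1 : ∀ x : E d, chi x 0 = 1 := fun x => by simp [chi]
  simp only [h1, one_mul] at h
  rw [integral_complex_ofReal, Q₀_zero hη hη' hρ] at h
  exact_mod_cast h.symm

end

/-! ### Multiplier bounds at unit scale -/

section

variable {d : ℕ} {η : ℝ} {ρ : ℝ → ℝ}

lemma ballRiesz_mono (hd : 1 ≤ d) {a b : ℝ} (ha : 0 < a) (hab : a ≤ b) (hb : b < d) :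
    ballRiesz d a ≤ ballRiesz d b := by
  refine setIntegral_mono_on (integrableOn_ball_riesz hd (hab.trans_lt hb) 1)
    (integrableOn_ball_riesz hd hb 1) measurableSet_ball fun z hz => ?_
  -- At the origin both powers are `0` by the convention for `0` to a nonzero exponent.
  rcases eq_or_ne z 0 with rfl | h
  · rw [norm_zero, Real.zero_rpow (by linarith), Real.zero_rpow (by linarith)]
  · exact Real.rpow_le_rpow_of_exponent_ge (norm_pos_iff.2 h) (mem_ball_zero_iff.1 hz).le (by linarith)

/-- On `r ≥ 1 / 2` the left side is bounded, and also at most linear in `|r - 1|`, with constants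
uniform in `a ≤ d`; `min x 1 ≤ √x` combines the two. -/
lemma abs_rpow_neg_sub_one_le {a r : ℝ} (ha : 0 < a) (had : a ≤ d) (hr : 1 / 2 ≤ r) :
    |r ^ (-a) - 1| ≤ (d + 2 ^ (d + 1)) * √|r - 1| := by
  have hr0 : 0 < r := by linarith
  have hd0 : (0 : ℝ) < d := ha.trans_le had
  have hp : (0 : ℝ) < 2 ^ (d + 1) := by positivity
  have hsq : ∀ x : ℝ, 0 ≤ x → ∀ D y : ℝ, 0 ≤ D → y ≤ D * x → y ≤ D → y ≤ D * √x := by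
    intro x hx D y hD h1 h2
    rcases le_or_gt x 1 with h | h
    · exact h1.trans (mul_le_mul_of_nonneg_left (Real.le_sqrt_of_sq_le (by nlinarith)) hD)
    · exact h2.trans (le_mul_of_one_le_right hD (Real.one_le_sqrt.2 h.le))
  rcases le_or_gt 1 r with h | h
  · have h1 : r ^ (-a) ≤ 1 := Real.rpow_le_one_of_one_le_of_nonpos h (by linarith)
    have h2 : 0 < r ^ (-a) := Real.rpow_pos_of_pos hr0 _
    rw [abs_of_nonpos (by linarith), abs_of_nonneg (by linarith)]
    refine hsq _ (by linarith) _ _ (by positivity) ?_ ?_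
    · have h3 : 1 - a * (r - 1) ≤ r ^ (-a) := by
        rw [Real.rpow_def_of_pos hr0]
        have h4 := Real.add_one_le_exp (Real.log r * -a)
        have h5 := Real.log_le_sub_one_of_pos hr0
        nlinarith
      nlinarith
    · have : (1 : ℝ) ≤ 2 ^ (d + 1) := one_le_pow₀ (by norm_num)
      linarith
  · have h1 : 1 ≤ r ^ (-a) := Real.one_le_rpow_of_pos_of_le_one_of_nonpos hr0 h.le (by linarith)
    rw [abs_of_nonneg (by linarith), abs_of_nonpos (by linarith)]
    have hu1 : 1 ≤ r⁻¹ := (one_le_inv₀ hr0).2 h.le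
    have hu2 : r⁻¹ ≤ 2 := by
      rw [inv_le_comm₀ hr0 two_pos]; linarith
    have h3 : r ^ (-a) ≤ r⁻¹ ^ d := by
      rw [Real.rpow_neg hr0.le, ← Real.inv_rpow hr0.le, ← Real.rpow_natCast]
      exact Real.rpow_le_rpow_of_exponent_le hu1 had
    have h4 := one_add_pow_le (δ := r⁻¹ - 1) (by linarith) (by linarith) d
    rw [add_sub_cancel] at h4
    have h5 : r⁻¹ - 1 ≤ 2 * (1 - r) := by
      have : r⁻¹ * r = 1 := inv_mul_cancel₀ hr0.ne'
      nlinarith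
    have h6 : (1 : ℝ) ≤ 2 ^ d := one_le_pow₀ (by norm_num)
    rw [pow_succ] at hp ⊢
    refine hsq _ (by linarith) _ _ (by positivity) ?_ ?_
    · nlinarith
    · nlinarith

/-- The Riesz potential of the Fourier transform of `Q₀`. -/
def potential (d : ℕ) (η : ℝ) (ρ : ℝ → ℝ) (a : ℝ) (k : E d) : ℝ :=
  ∫ l, ‖l - k‖ ^ (-a) * Q₀Fourier d η ρ l

lemma potential_nonneg (hη' : η ≤ 1 / 2) (hρ : IsProfile η ρ) (a : ℝ) (k : E d) :
    0 ≤ potential d η ρ a k :=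
  integral_nonneg fun l => mul_nonneg (by positivity) (Q₀Fourier_nonneg hη' hρ l)

lemma exists_potential_bound (hd : 1 ≤ d) {ε : ℝ} (hε : 0 < ε) (hη : 0 < η)
    (hη' : η ≤ 1 / 2) (hρ : IsProfile η ρ) :
    ∃ C : ℝ, 0 ≤ C ∧ ∀ a : ℝ, ε ≤ a → a ≤ d - ε → ∀ k, potential d η ρ a k ≤ C := by
  have hI := (integral_Q₀_pos (d := d) hη hη' hρ).le
  have hb := ballRiesz_nonneg d (d - ε)
  refine ⟨(∫ x, Q₀ d η ρ x) * ballRiesz d (d - ε) + 1, by positivity, fun a ha ha' k => ?_⟩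
  have h := integral_riesz_mul_le hd (hε.le.trans ha) (by linarith)
    (integrable_Q₀Fourier hd hη hη' hρ) (Q₀Fourier_nonneg hη' hρ) (Q₀Fourier_le hη hη' hρ) k
  rw [integral_Q₀Fourier hd hη hη' hρ] at h
  have hm := ballRiesz_mono hd (hε.trans_le ha) ha' (by linarith)
  refine h.trans ?_
  gcongr

/-- Since the transform has integral one, the quantity is the integral of `(‖l - k‖ / ‖k‖) ^ (-a) -
1` against it. Away from `l = k` this factor is `O(√(‖l‖ / ‖k‖))`, handled by the half moment. Near
`k` one has `‖l‖ ≥ ‖k‖ / 2`, so the transform is `O(‖k‖ ^ (-(d + 1)))` while the rescaled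
singularity integrates to `O(‖k‖ ^ d)`. -/
lemma exists_potential_asymptotic (hd : 1 ≤ d) {ε : ℝ} (hε : 0 < ε) (hη : 0 < η)
    (hη' : η ≤ 1 / 2) (hρ : IsProfile η ρ) :
    ∃ C : ℝ, 0 ≤ C ∧ ∀ a : ℝ, ε ≤ a → a ≤ d - ε → ∀ k : E d, 1 ≤ ‖k‖ →
      |‖k‖ ^ a * potential d η ρ a k - 1| ≤ C / √‖k‖ := by
  obtain ⟨C, hC0, hC⟩ := exists_Q₀Fourier_decay hd hη' hρ
  set N := ∫ l, √‖l‖ * Q₀Fourier d η ρ l with hN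
  have hN0 : 0 ≤ N := integral_nonneg fun l =>
    mul_nonneg (Real.sqrt_nonneg _) (Q₀Fourier_nonneg hη' hρ l)
  set D : ℝ := d + 2 ^ (d + 1) with hD
  have hD1 : 1 ≤ D := by
    have : (1 : ℝ) ≤ 2 ^ (d + 1) := one_le_pow₀ (by norm_num)
    have : (0 : ℝ) ≤ d := Nat.cast_nonneg d
    linarith
  have hbr := ballRiesz_nonneg d (d - ε)
  refine ⟨D * N + C * 2 ^ (d + 1) * ballRiesz d (d - ε), by positivity, fun a ha ha' k hk => ?_⟩
  have ha0 : 0 < a := hε.trans_le ha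
  have hk0 : 0 < ‖k‖ := by linarith
  set h : E d → ℝ := (Metric.ball (0 : E d) 1).indicator fun z => ‖z‖ ^ (-a) with hh
  have hhi : Integrable h := (integrable_indicator_iff measurableSet_ball).2
    (integrableOn_ball_riesz hd (by linarith) 1)
  have hh0 : ∀ z, 0 ≤ h z := fun z => indicator_nonneg (fun _ _ => by positivity) _
  have hhint : ∫ z, h z = ballRiesz d a := integral_indicator measurableSet_ball
  have hm0 := Q₀Fourier_nonneg (d := d) hη' hρ
  have hmi := integrable_Q₀Fourier (d := d) hd hη hη' hρ
  have hpoint : ∀ l, |(‖l - k‖ / ‖k‖) ^ (-a) - 1| * Q₀Fourier d η ρ l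
      ≤ D / √‖k‖ * (√‖l‖ * Q₀Fourier d η ρ l)
        + C * 2 ^ (d + 1) / ‖k‖ ^ (d + 1) * h (‖k‖⁻¹ • (l - k)) := by
    intro l
    have hr1 : |‖l - k‖ / ‖k‖ - 1| ≤ ‖l‖ / ‖k‖ := by
      rw [div_sub_one hk0.ne', abs_div, abs_of_pos hk0]
      gcongr
      have := abs_norm_sub_norm_le (l - k) (-k)
      simpa using this
    have hsq : √(‖l‖ / ‖k‖) = √‖l‖ / √‖k‖ := Real.sqrt_div (norm_nonneg l) _
    have hterm2 : 0 ≤ C * 2 ^ (d + 1) / ‖k‖ ^ (d + 1) * h (‖k‖⁻¹ • (l - k)) :=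
      mul_nonneg (by positivity) (hh0 _)
    rcases le_or_gt (1 / 2) (‖l - k‖ / ‖k‖) with hr | hr
    · have h1 := abs_rpow_neg_sub_one_le (d := d) ha0 (by linarith) hr
      have h2 : √|‖l - k‖ / ‖k‖ - 1| ≤ √‖l‖ / √‖k‖ := by
        rw [← hsq]; exact Real.sqrt_le_sqrt hr1
      have h3 : |(‖l - k‖ / ‖k‖) ^ (-a) - 1| ≤ D * (√‖l‖ / √‖k‖) :=
        h1.trans (mul_le_mul_of_nonneg_left h2 (by linarith))
      calc _ ≤ D * (√‖l‖ / √‖k‖) * Q₀Fourier d η ρ l :=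
            mul_le_mul_of_nonneg_right h3 (hm0 l)
        _ = D / √‖k‖ * (√‖l‖ * Q₀Fourier d η ρ l) := by ring
        _ ≤ _ := le_add_of_nonneg_right hterm2
    · have hlk : ‖k‖ / 2 ≤ ‖l‖ := by
        have h1 := (abs_le.1 hr1).1
        have h2 : 1 / 2 ≤ ‖l‖ / ‖k‖ := by linarith
        rw [le_div_iff₀ hk0] at h2
        linarith
      have hterm1 : 0 ≤ D / √‖k‖ * (√‖l‖ * Q₀Fourier d η ρ l) :=
        mul_nonneg (by positivity) (mul_nonneg (Real.sqrt_nonneg _) (hm0 l))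
      -- At `l = k` the power is `0` by convention, so the factor has modulus `1` and the first term
      -- of the majorant absorbs it.
      rcases eq_or_ne l k with rfl | hne
      · rw [sub_self, norm_zero, zero_div, Real.zero_rpow (by linarith), zero_sub, abs_neg,
          abs_one, one_mul]
        have : D / √‖l‖ * (√‖l‖ * Q₀Fourier d η ρ l) = D * Q₀Fourier d η ρ l := by
          have := Real.sqrt_pos.2 hk0
          field_simp
        rw [sub_self] at hterm2
        rw [this]
        nlinarith [hm0 l]
      · have hr0 : 0 < ‖l - k‖ / ‖k‖ := div_pos (norm_pos_iff.2 (sub_ne_zero.2 hne)) hk0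
        have h1 : 1 ≤ (‖l - k‖ / ‖k‖) ^ (-a) :=
          Real.one_le_rpow_of_pos_of_le_one_of_nonpos hr0 (by linarith) (by linarith)
        have hnorm : ‖‖k‖⁻¹ • (l - k)‖ = ‖l - k‖ / ‖k‖ := by
          rw [norm_smul, norm_inv, norm_norm, div_eq_inv_mul]
        have hhv : h (‖k‖⁻¹ • (l - k)) = (‖l - k‖ / ‖k‖) ^ (-a) := by
          rw [hh, indicator_of_mem, hnorm]
          rw [mem_ball_zero_iff, hnorm]
          linarith
        have hl0 : 0 < ‖l‖ := by linarith
        have hml : Q₀Fourier d η ρ l ≤ C * 2 ^ (d + 1) / ‖k‖ ^ (d + 1) := by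
          refine (hC l (norm_pos_iff.1 hl0)).trans ?_
          rw [div_le_div_iff₀ (by positivity) (by positivity), mul_assoc, ← mul_pow]
          gcongr
          linarith
        rw [abs_of_nonneg (by linarith), hhv]
        calc _ ≤ (‖l - k‖ / ‖k‖) ^ (-a) * Q₀Fourier d η ρ l :=
              mul_le_mul_of_nonneg_right (by linarith) (hm0 l)
          _ ≤ (‖l - k‖ / ‖k‖) ^ (-a) * (C * 2 ^ (d + 1) / ‖k‖ ^ (d + 1)) :=
              mul_le_mul_of_nonneg_left hml (by linarith)
          _ = C * 2 ^ (d + 1) / ‖k‖ ^ (d + 1) * (‖l - k‖ / ‖k‖) ^ (-a) := mul_comm _ _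
          _ ≤ _ := le_add_of_nonneg_left hterm1
  have hscale : ∀ l, (‖l - k‖ / ‖k‖) ^ (-a) = ‖k‖ ^ a * ‖l - k‖ ^ (-a) := by
    intro l
    rw [Real.div_rpow (norm_nonneg _) (norm_nonneg _), Real.rpow_neg (norm_nonneg k),
      div_inv_eq_mul, mul_comm]
  have hJi := integrable_riesz_mul hd ha0.le (by linarith) hmi hm0 (Q₀Fourier_le hη hη' hρ) k
  have heq : ‖k‖ ^ a * potential d η ρ a k - 1
      = ∫ l, ((‖l - k‖ / ‖k‖) ^ (-a) - 1) * Q₀Fourier d η ρ l := by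
    have e1 : ∀ l, ((‖l - k‖ / ‖k‖) ^ (-a) - 1) * Q₀Fourier d η ρ l
        = ‖k‖ ^ a * (‖l - k‖ ^ (-a) * Q₀Fourier d η ρ l) - Q₀Fourier d η ρ l := by
      intro l
      rw [hscale]
      ring
    simp_rw [e1]
    rw [integral_sub (hJi.const_mul _) hmi, integral_const_mul, integral_Q₀Fourier hd hη hη' hρ,
      potential]
  have hhs : Integrable fun l => h (‖k‖⁻¹ • (l - k)) :=
    ((hhi.comp_smul (inv_ne_zero hk0.ne')).comp_sub_right k)
  have hhs' : ∫ l, h (‖k‖⁻¹ • (l - k)) = ‖k‖ ^ d * ballRiesz d a := by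
    rw [integral_sub_right_eq_self (fun l => h (‖k‖⁻¹ • l)) k,
      Measure.integral_comp_inv_smul_of_nonneg _ _ hk0.le, hhint]
    simp
  have hsi := integrable_sqrt_norm_mul_Q₀Fourier (d := d) hd hη hη' hρ
  rw [heq, ← Real.norm_eq_abs]
  refine (norm_integral_le_of_norm_le ((hsi.const_mul (D / √‖k‖)).add
    (hhs.const_mul (C * 2 ^ (d + 1) / ‖k‖ ^ (d + 1))))
    (Filter.Eventually.of_forall fun l => ?_)).trans ?_
  · rw [norm_mul, Real.norm_eq_abs, Real.norm_of_nonneg (hm0 l)]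
    exact hpoint l
  · simp only [Pi.add_apply]
    rw [integral_add (hsi.const_mul _) (hhs.const_mul _), integral_const_mul, integral_const_mul,
      hhs', ← hN]
    have hmono := ballRiesz_mono hd ha0 ha' (by linarith)
    have hs1 : √‖k‖ ≤ ‖k‖ := by
      rw [Real.sqrt_le_left hk0.le]
      nlinarith
    have hs0 : 0 < √‖k‖ := Real.sqrt_pos.2 hk0
    calc D / √‖k‖ * N + C * 2 ^ (d + 1) / ‖k‖ ^ (d + 1) * (‖k‖ ^ d * ballRiesz d a)
        = D * N / √‖k‖ + C * 2 ^ (d + 1) * ballRiesz d a / ‖k‖ := by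
          rw [pow_succ ‖k‖]
          field_simp
      _ ≤ D * N / √‖k‖ + C * 2 ^ (d + 1) * ballRiesz d (d - ε) / √‖k‖ := by gcongr
      _ = _ := by ring

/-- On the support `‖x‖ ≤ 3` the phase is at most `2 π · 3 ‖k‖`, and `|1 - exp (i θ)| ≤ |θ|`. -/
lemma abs_one_sub_Q₀Fourier_div_le (hη : 0 < η) (hη' : η ≤ 1 / 2) (hρ : IsProfile η ρ)
    (k : E d) : |1 - Q₀Fourier d η ρ k / ∫ x, Q₀ d η ρ x| ≤ 6 * Real.pi * ‖k‖ := by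
  have hI := integral_Q₀_pos (d := d) hη hη' hρ
  have hi := integrable_Q₀ (d := d) hη hη' hρ
  have hic : Integrable fun x => (Q₀ d η ρ x : ℂ) := hi.ofReal
  have hpi := Real.pi_pos
  rw [one_sub_div hI.ne', abs_div, abs_of_pos hI, div_le_iff₀ hI, ← Real.norm_eq_abs,
    ← Complex.norm_real, Complex.ofReal_sub, ← fourier_Q₀ hη hη' hρ, fourier_eq_chi,
    ← integral_complex_ofReal, ← integral_sub hic (integrable_chi_mul hic _),
    ← integral_const_mul]
  refine norm_integral_le_of_norm_le (hi.const_mul _) (Filter.Eventually.of_forall fun x => ?_)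
  have h0 := Q₀_nonneg hη hη' hρ x
  rw [← one_sub_mul, norm_mul, Complex.norm_real, Real.norm_of_nonneg h0]
  rcases le_or_gt ‖x‖ 3 with hx | hx
  · refine mul_le_mul_of_nonneg_right ?_ h0
    have h1 : ‖1 - chi (-k) x‖ ≤ ‖2 * Real.pi * inner ℝ (-k) x‖ := by
      rw [norm_sub_rev, chi, mul_comm]
      exact Real.norm_exp_I_mul_ofReal_sub_one_le
    refine h1.trans ?_
    rw [norm_mul, Real.norm_of_nonneg (by positivity)]
    have h2 : ‖inner ℝ (-k) x‖ ≤ ‖k‖ * ‖x‖ := by simpa using norm_inner_le_norm (𝕜 := ℝ) (-k) x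
    calc 2 * Real.pi * ‖inner ℝ (-k) x‖ ≤ 2 * Real.pi * (‖k‖ * 3) := by
          gcongr
          exact h2.trans (by gcongr)
      _ = _ := by ring
  · have : Q₀ d η ρ x = 0 := by
      rw [Q₀_eq hη hη']
      refine setIntegral_eq_zero_of_forall_eq_zero fun t ht => ?_
      rw [ballOverlap_inv_smul_eq_zero hη' hx ht, zero_mul]
    rw [this]
    simp

/-- The ratio of the multiplier of the error kernel to that of the Riesz kernel, at unit scale. -/
def errRatio (d : ℕ) (η : ℝ) (ρ : ℝ → ℝ) (a : ℝ) (k : E d) : ℝ :=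
  1 - ‖k‖ ^ a * potential d η ρ a k - Q₀Fourier d η ρ k / ∫ x, Q₀ d η ρ x

/-- Uniform bounds on the multipliers at unit scale. -/
theorem exists_multiplier_bound (hd : 1 ≤ d) {ε : ℝ} (hε : 0 < ε) (hη : 0 < η)
    (hη' : η ≤ 1 / 2) (hρ : IsProfile η ρ) :
    ∃ C : ℝ, 0 < C ∧ ∀ a : ℝ, ε ≤ a → a ≤ d - ε → ∀ k : E d, k ≠ 0 →
      ‖k‖ ^ a * potential d η ρ a k ≤ C ∧
      |errRatio d η ρ a k|
        ≤ C * min (‖k‖ ^ min ε (1 / 2)) (‖k‖ ^ min ε (1 / 2))⁻¹ := by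
  obtain ⟨C₁, h₁, H₁⟩ := exists_potential_bound (d := d) hd hε hη hη' hρ
  obtain ⟨C₂, h₂, H₂⟩ := exists_potential_asymptotic (d := d) hd hε hη hη' hρ
  obtain ⟨C₃, h₃, H₃⟩ := exists_Q₀Fourier_decay hd hη' hρ
  have hI := integral_Q₀_pos (d := d) hη hη' hρ
  set I := ∫ x, Q₀ d η ρ x with hIdef
  have hpi := Real.pi_pos
  -- The first two summands serve `‖k‖ ≤ 1`, the bracket serves `‖k‖ > 1`. In the exponent, `ε`
  -- comes from `‖k‖ ^ a` at low frequency and `1 / 2` from the high-frequency asymptotics.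
  refine ⟨C₁ + 6 * Real.pi + (1 + C₂ + C₃ / I), by positivity, fun a ha ha' k hk => ?_⟩
  have hk0 : 0 < ‖k‖ := norm_pos_iff.2 hk
  have hJ0 := potential_nonneg hη' hρ a k
  have hm0 := Q₀Fourier_nonneg hη' hρ k
  have hq0 : 0 ≤ C₃ / I := by positivity
  set e := min ε (1 / 2) with he
  have he0 : 0 < e := lt_min hε (by norm_num)
  have heε : e ≤ ε := min_le_left _ _
  have he2 : e ≤ 1 / 2 := min_le_right _ _
  have hp : 0 < ‖k‖ ^ e := Real.rpow_pos_of_pos hk0 _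
  rcases le_or_gt ‖k‖ 1 with h | h
  · have hpe : ‖k‖ ^ e ≤ 1 := Real.rpow_le_one hk0.le h he0.le
    have hpa : ‖k‖ ^ a ≤ ‖k‖ ^ e := Real.rpow_le_rpow_of_exponent_ge hk0 h (by linarith)
    have hp1 : ‖k‖ ≤ ‖k‖ ^ e := by
      simpa using Real.rpow_le_rpow_of_exponent_ge hk0 h (show e ≤ 1 by linarith)
    have hJ : ‖k‖ ^ a * potential d η ρ a k ≤ ‖k‖ ^ e * C₁ :=
      mul_le_mul hpa (H₁ a ha ha' k) hJ0 hp.le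
    have hJ' : 0 ≤ ‖k‖ ^ a * potential d η ρ a k := by positivity
    refine ⟨hJ.trans (by nlinarith), ?_⟩
    rw [min_eq_left (hpe.trans ((one_le_inv₀ hp).2 hpe))]
    have h3 := abs_one_sub_Q₀Fourier_div_le hη hη' hρ k
    rw [abs_le] at h3
    have h4 : 6 * Real.pi * ‖k‖ ≤ 6 * Real.pi * ‖k‖ ^ e := by gcongr
    have h5 : 0 ≤ (1 + C₂ + C₃ / I) * ‖k‖ ^ e := by positivity
    have h6 : 0 ≤ C₁ * ‖k‖ ^ e := by positivity
    rw [errRatio, abs_le]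
    constructor <;> nlinarith [h3.1, h3.2]
  · have hpe : 1 ≤ ‖k‖ ^ e := Real.one_le_rpow h.le he0.le
    have hs0 : 0 < √‖k‖ := Real.sqrt_pos.2 hk0
    have hs1 : 1 ≤ √‖k‖ := Real.one_le_sqrt.2 h.le
    have hpes : ‖k‖ ^ e ≤ √‖k‖ := by
      rw [Real.sqrt_eq_rpow]
      exact Real.rpow_le_rpow_of_exponent_le h.le he2
    have h2 := H₂ a ha ha' k h.le
    have hC2 : C₂ / √‖k‖ ≤ C₂ * (‖k‖ ^ e)⁻¹ := by
      rw [div_eq_mul_inv]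
      gcongr
    have hinv : (‖k‖ ^ e)⁻¹ ≤ 1 := inv_le_one_of_one_le₀ hpe
    have hinv0 : 0 < (‖k‖ ^ e)⁻¹ := inv_pos.2 hp
    have hq : Q₀Fourier d η ρ k / I ≤ C₃ / I * (‖k‖ ^ e)⁻¹ := by
      have h4 : ‖k‖ ^ e ≤ ‖k‖ ^ (d + 1) := by
        rw [← Real.rpow_natCast]
        refine Real.rpow_le_rpow_of_exponent_le h.le ?_
        push_cast
        have : (0 : ℝ) ≤ d := Nat.cast_nonneg d
        linarith
      calc _ ≤ C₃ / ‖k‖ ^ (d + 1) / I := by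
            gcongr
            exact H₃ k hk
        _ ≤ C₃ / ‖k‖ ^ e / I := by gcongr
        _ = _ := by ring
    have hq' : 0 ≤ Q₀Fourier d η ρ k / I := by positivity
    rw [abs_le] at h2
    refine ⟨?_, ?_⟩
    · nlinarith [h2.2]
    · rw [min_eq_right (hinv.trans hpe), errRatio, abs_le]
      have h5 : 0 ≤ (C₁ + 6 * Real.pi + 1) * (‖k‖ ^ e)⁻¹ := by positivity
      constructor <;> nlinarith [h2.1, h2.2]

end

/-! ### Lacunary sums and the kernels -/

section

variable {d : ℕ} {η : ℝ} {ρ : ℝ → ℝ}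

/-- The increasing concave potential `y` for `y ≤ 1`, `2 - 1 / y` for `1 ≤ y`. -/
def lacunaryPotential (y : ℝ) : ℝ := if y ≤ 1 then y else 2 - y⁻¹

lemma lacunaryPotential_le_two {y : ℝ} (hy : 0 < y) : lacunaryPotential y ≤ 2 := by
  have := inv_pos.2 hy
  unfold lacunaryPotential
  split_ifs <;> linarith

lemma lacunaryPotential_nonneg {y : ℝ} (hy : 0 < y) : 0 ≤ lacunaryPotential y := by
  unfold lacunaryPotential
  split_ifs with h
  · exact hy.le
  · have : y⁻¹ ≤ 1 := inv_le_one_of_one_le₀ (by linarith)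
    linarith

lemma lacunaryPotential_mono {x y : ℝ} (hx : 0 < x) (hxy : x ≤ y) :
    lacunaryPotential x ≤ lacunaryPotential y := by
  unfold lacunaryPotential
  split_ifs with h1 h2 h2
  · exact hxy
  · have : y⁻¹ ≤ 1 := inv_le_one_of_one_le₀ (by linarith)
    linarith
  · linarith
  · have : y⁻¹ ≤ x⁻¹ := inv_anti₀ hx hxy
    linarith

/-- The potential is concave with derivative `min 1 (y⁻¹ ^ 2)`, which is `min y y⁻¹` divided by `y`.
Its increment from `y / μ` to `y` is thus at least `(y - y / μ)` times the derivative at `y`, and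
this makes lacunary sums telescope. -/
lemma min_le_lacunaryPotential_sub {μ x y : ℝ} (hμ : 1 < μ) (hx : 0 < x) (hxy : μ * x ≤ y) :
    min y y⁻¹ ≤ μ / (μ - 1) * (lacunaryPotential y - lacunaryPotential x) := by
  have hμ0 : 0 < μ := by linarith
  have hy : 0 < y := lt_of_lt_of_le (by positivity) hxy
  have hz : 0 < y / μ := by positivity
  have hmono := lacunaryPotential_mono hx ((le_div_iff₀' hμ0).2 hxy)
  suffices h : (μ - 1) / μ * min y y⁻¹ ≤ lacunaryPotential y - lacunaryPotential (y / μ) by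
    have h1 : 0 < μ - 1 := by linarith
    calc min y y⁻¹ = μ / (μ - 1) * ((μ - 1) / μ * min y y⁻¹) := by field_simp
      _ ≤ μ / (μ - 1) * (lacunaryPotential y - lacunaryPotential x) := by
        gcongr
        linarith
  obtain ⟨z, hz_def⟩ : ∃ z, z = y / μ := ⟨_, rfl⟩
  rw [← hz_def] at hz ⊢
  have hyz : y = μ * z := by rw [hz_def]; field_simp
  have hk : (μ - 1) / μ * y = y - z := by rw [hyz]; field_simp
  have hk' : 0 < (μ - 1) / μ := div_pos (by linarith) hμ0
  have hzy : z ≤ y := by nlinarith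
  rcases le_or_gt y 1 with h | h
  · calc (μ - 1) / μ * min y y⁻¹ ≤ (μ - 1) / μ * y := by gcongr; exact min_le_left _ _
      _ = _ := by
        rw [hk, lacunaryPotential, lacunaryPotential, if_pos h, if_pos (hzy.trans h)]
  · have hstep : (μ - 1) / μ * min y y⁻¹ ≤ (y - z) * (y⁻¹ * y⁻¹) := by
      calc (μ - 1) / μ * min y y⁻¹ ≤ (μ - 1) / μ * y⁻¹ := by gcongr; exact min_le_right _ _
        _ = (μ - 1) / μ * y * (y⁻¹ * y⁻¹) := by field_simp
        _ = _ := by rw [hk]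
    refine hstep.trans ?_
    rw [lacunaryPotential, if_neg (not_le.2 h), lacunaryPotential]
    have hw : y * y⁻¹ = 1 := mul_inv_cancel₀ hy.ne'
    have hw0 : 0 < y⁻¹ := inv_pos.2 hy
    have hw1 : y⁻¹ < 1 := inv_lt_one_of_one_lt₀ h
    have e : (y - z) * (y⁻¹ * y⁻¹) = y⁻¹ - z * (y⁻¹ * y⁻¹) := by
      have : (y - z) * (y⁻¹ * y⁻¹) = y * y⁻¹ * y⁻¹ - z * (y⁻¹ * y⁻¹) := by ring
      rw [this, hw, one_mul]
    split_ifs with hz1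
    · rw [e]
      -- With `w = y⁻¹`, the right side minus the left factors as `(1 - w) (2 - z (1 + w))`.
      nlinarith [mul_nonneg (sub_nonneg.2 hw1.le)
        (show 0 ≤ 2 - z * (1 + y⁻¹) by nlinarith)]
    · have hv : z * z⁻¹ = 1 := mul_inv_cancel₀ hz.ne'
      have hvw : y⁻¹ ≤ z⁻¹ := inv_anti₀ hz hzy
      have e2 : z⁻¹ - y⁻¹ = (y - z) * (y⁻¹ * z⁻¹) := by field_simp
      have : (y - z) * (y⁻¹ * y⁻¹) ≤ (y - z) * (y⁻¹ * z⁻¹) := by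
        have : 0 ≤ y - z := by linarith
        gcongr
      linarith

/-- A lacunary sum of `min y y⁻¹` is bounded independently of the number of terms. -/
lemma sum_min_inv_le {μ : ℝ} (hμ : 1 < μ) {M : ℕ} (hM : 1 ≤ M) {y : ℕ → ℝ} (h1 : 0 < y 1)
    (hy : ∀ k, 1 ≤ k → k < M → μ * y k ≤ y (k + 1)) :
    ∑ i ∈ Finset.Icc 1 M, min (y i) (y i)⁻¹ ≤ 2 * (μ / (μ - 1)) := by
  have hμ1 : 0 < μ - 1 := by linarith
  have hK : 0 ≤ μ / (μ - 1) := div_nonneg (by linarith) hμ1.le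
  -- The bound by the potential at the last term is what telescopes; the uniform bound follows
  -- because the potential is at most `2`.
  have key : ∀ n, 1 ≤ n → n ≤ M → 0 < y n ∧
      ∑ i ∈ Finset.Icc 1 n, min (y i) (y i)⁻¹ ≤ μ / (μ - 1) * lacunaryPotential (y n) := by
    intro n hn
    induction n, hn using Nat.le_induction with
    | base =>
      intro _
      refine ⟨h1, ?_⟩
      have hK1 : 1 ≤ μ / (μ - 1) := by
        rw [le_div_iff₀ hμ1]; linarith
      have h0 := lacunaryPotential_nonneg h1
      have h2 : min (y 1) (y 1)⁻¹ ≤ lacunaryPotential (y 1) := by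
        unfold lacunaryPotential
        split_ifs with h
        · exact min_le_left _ _
        · have : (y 1)⁻¹ ≤ 1 := inv_le_one_of_one_le₀ (by linarith)
          exact (min_le_right _ _).trans (by linarith)
      simpa using h2.trans (le_mul_of_one_le_left h0 hK1)
    | succ n hn ih =>
      intro hnM
      obtain ⟨h0, hs⟩ := ih (by omega)
      have hstep := hy n hn (by omega)
      refine ⟨lt_of_lt_of_le (mul_pos (by linarith) h0) hstep, ?_⟩
      rw [Finset.sum_Icc_succ_top (by omega)]
      have := min_le_lacunaryPotential_sub hμ h0 hstep
      rw [mul_sub] at this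
      linarith
  obtain ⟨h0, hs⟩ := key M hM le_rfl
  calc _ ≤ μ / (μ - 1) * lacunaryPotential (y M) := hs
    _ ≤ μ / (μ - 1) * 2 := by gcongr; exact lacunaryPotential_le_two h0
    _ = _ := mul_comm _ _

lemma one_lt_growth (hd : 1 ≤ d) : 1 < 1 + 4 * √(d : ℝ) * volB d 1 := by
  have h1 := volB_one_pos (d := d)
  have h2 : 0 < √(d : ℝ) := Real.sqrt_pos.2 (by exact_mod_cast hd)
  have : 0 < 4 * √(d : ℝ) * volB d 1 := by positivity
  linarith

lemma IsScales.pos_of_mem {M : ℕ} {R : ℕ → ℝ} (hR : IsScales d M R) {i : ℕ} (hi : 1 ≤ i)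
    (hiM : i ≤ M) : 0 < R i := by
  induction i, hi using Nat.le_induction with
  | base => exact hR.pos
  | succ n hn ih =>
    have h1 := volB_one_pos (d := d)
    exact lt_trans (mul_pos (by positivity) (ih (by omega))) (hR.growth n hn (by omega))

/-! ### Symbols of the kernels at scale `R` -/

section Kernels

variable {s : ℝ} {R : ℝ}

lemma hasSymbol_Q_riesz (hd : 1 ≤ d) (hη : 0 < η) (hη' : η ≤ 1 / 2) (hρ : IsProfile η ρ)
    (hs : 0 < s) (hsd : s < d) (hR : 0 < R) :
    HasSymbol (fun x : E d => Q d η ρ R x / ‖x‖ ^ s) (fun k => rieszConst d s *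
      (R ^ (d - s) * potential d η ρ (d - s) (-(R • k)))) := by
  have h := hasSymbol_mul_riesz hd hs hsd (continuous_Q₀ (d := d) hη hη' hρ)
    (integrable_Q₀Fourier hd hη hη' hρ) (Q₀_eq_integral_chi hd hη hη' hρ) hR
  convert h using 2 with x
  · rw [Q, Real.rpow_neg (norm_nonneg _), div_eq_mul_inv]
  · rw [potential]

lemma integral_chi_mul_Q (hη : 0 < η) (hη' : η ≤ 1 / 2) (hρ : IsProfile η ρ) (hR : 0 < R)
    (k : E d) : ∫ y, chi y k * (Q d η ρ R y : ℂ)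
      = ((R ^ d * Q₀Fourier d η ρ (-(R • k)) : ℝ) : ℂ) := by
  have h := Measure.integral_comp_inv_smul_of_nonneg (volume : Measure (E d))
    (fun y => chi (R • k) y * (Q₀ d η ρ y : ℂ)) hR.le
  have h2 := fourier_Q₀ hη hη' hρ (-(R • k))
  rw [fourier_eq_chi, neg_neg] at h2
  rw [h2] at h
  simp only [finrank_euclideanSpace, Fintype.card_fin] at h
  calc _ = ∫ y, chi (R • k) (R⁻¹ • y) * (Q₀ d η ρ (R⁻¹ • y) : ℂ) := by
        refine integral_congr_ae (Filter.Eventually.of_forall fun y => ?_)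
        simp only
        rw [chi_smul, smul_smul, inv_mul_cancel₀ hR.ne', one_smul, chi_comm, Q]
    _ = _ := by
        rw [h]
        simp

lemma integral_Q (hR : 0 < R) : ∫ y, Q d η ρ R y = R ^ d * ∫ y, Q₀ d η ρ y := by
  have h := Measure.integral_comp_inv_smul_of_nonneg (volume : Measure (E d))
    (fun y => Q₀ d η ρ y) hR.le
  simpa [Q] using h

lemma hasSymbol_avgRiesz (hd : 1 ≤ d) (hη : 0 < η) (hη' : η ≤ 1 / 2) (hρ : IsProfile η ρ)
    (hs : 0 < s) (hsd : s < d) (hR : 0 < R) :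
    HasSymbol (avgRiesz d η ρ s R) (fun k => rieszConst d s * (‖k‖ ^ (-(d - s)) *
      (Q₀Fourier d η ρ (-(R • k)) / ∫ x, Q₀ d η ρ x))) := by
  have hQc : Continuous (Q d η ρ R) := (continuous_Q₀ hη hη' hρ).comp (by fun_prop)
  have hQs : HasCompactSupport (Q d η ρ R) :=
    (hasCompactSupport_Q₀ hη hη').comp_homeomorph
      (Homeomorph.smulOfNeZero R⁻¹ (inv_ne_zero hR.ne'))
  have h := (hasSymbol_convolution_riesz hd hs hsd hQc hQs
    (integral_chi_mul_Q hη hη' hρ hR)).const_mul (∫ y, Q d η ρ R y)⁻¹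
  convert h using 2 with x k
  · rw [avgRiesz]
    congr 1
    refine integral_congr_ae (Filter.Eventually.of_forall fun y => ?_)
    simp only
    rw [Real.rpow_neg (norm_nonneg _), div_eq_mul_inv]
  · rw [integral_Q hR]
    have hI := (integral_Q₀_pos (d := d) hη hη' hρ).ne'
    have := (pow_pos hR d).ne'
    field_simp

/-- Extracts the Riesz factor `‖k‖ ^ (-a)`, leaving a function of `-(R • k)` alone, so that the
unit-scale bounds apply at every scale. -/
lemma rpow_scale (hR : 0 < R) {k : E d} (hk : k ≠ 0) (a : ℝ) :
    R ^ a = ‖k‖ ^ (-a) * ‖-(R • k)‖ ^ a := by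
  have hk0 : 0 < ‖k‖ := norm_pos_iff.2 hk
  rw [norm_neg, norm_smul, Real.norm_of_nonneg hR.le, Real.mul_rpow hR.le hk0.le, mul_left_comm,
    ← Real.rpow_add hk0, neg_add_cancel, Real.rpow_zero, mul_one]

lemma hasSymbol_errRiesz (hd : 1 ≤ d) (hη : 0 < η) (hη' : η ≤ 1 / 2) (hρ : IsProfile η ρ)
    (hs : 0 < s) (hsd : s < d) (hR : 0 < R) :
    HasSymbol (errRiesz d η ρ s R) (fun k => rieszConst d s * ‖k‖ ^ (-(d - s))
      - rieszConst d s * (R ^ (d - s) * potential d η ρ (d - s) (-(R • k)))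
      - rieszConst d s * (‖k‖ ^ (-(d - s)) *
        (Q₀Fourier d η ρ (-(R • k)) / ∫ x, Q₀ d η ρ x))) := by
  have h := ((hasSymbol_riesz hd hs hsd).sub (hasSymbol_Q_riesz hd hη hη' hρ hs hsd hR)).sub
    (hasSymbol_avgRiesz hd hη hη' hρ hs hsd hR)
  convert h using 2 with x
  rw [errRiesz, sub_div, Real.rpow_neg (norm_nonneg _), one_div]

lemma errSymbol_eq (hR : 0 < R) {k : E d} (hk : k ≠ 0) :
    rieszConst d s * ‖k‖ ^ (-(d - s))
      - rieszConst d s * (R ^ (d - s) * potential d η ρ (d - s) (-(R • k)))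
      - rieszConst d s * (‖k‖ ^ (-(d - s)) *
        (Q₀Fourier d η ρ (-(R • k)) / ∫ x, Q₀ d η ρ x))
      = rieszConst d s * ‖k‖ ^ (-(d - s)) * errRatio d η ρ (d - s) (-(R • k)) := by
  rw [rpow_scale hR hk, errRatio]
  ring

end Kernels

/-- The sum over lacunary scales of the error ratios is bounded. -/
lemma abs_sum_errRatio_le (hd : 1 ≤ d) {C e a : ℝ} (hC : 0 ≤ C) (he : 0 < e)
    (H : ∀ k : E d, k ≠ 0 → |errRatio d η ρ a k| ≤ C * min (‖k‖ ^ e) (‖k‖ ^ e)⁻¹)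
    {M : ℕ} (hM : 1 ≤ M) {R : ℕ → ℝ} (hR : IsScales d M R) {k : E d} (hk : k ≠ 0) :
    |∑ i ∈ Finset.Icc 1 M, errRatio d η ρ a (-(R i • k))|
      ≤ C * (2 * ((1 + 4 * √(d : ℝ) * volB d 1) ^ e /
        ((1 + 4 * √(d : ℝ) * volB d 1) ^ e - 1))) := by
  have hg := one_lt_growth hd
  set g := 1 + 4 * √(d : ℝ) * volB d 1 with hgdef
  have hk0 : 0 < ‖k‖ := norm_pos_iff.2 hk
  -- The growth condition makes `(R i * ‖k‖) ^ e` lacunary with ratio `g ^ e > 1`, whatever the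
  -- value of `k`.
  have hsum := sum_min_inv_le (μ := g ^ e) (Real.one_lt_rpow hg he) hM
    (y := fun i => (R i * ‖k‖) ^ e) (Real.rpow_pos_of_pos (mul_pos hR.pos hk0) _) (by
      intro j hj hjM
      have hRj := hR.pos_of_mem hj hjM.le
      have hgr := hR.growth j hj hjM
      rw [← Real.mul_rpow (by linarith) (by positivity), ← mul_assoc]
      gcongr)
  refine (Finset.abs_sum_le_sum_abs _ _).trans
    (le_trans ?_ (mul_le_mul_of_nonneg_left hsum hC))
  rw [Finset.mul_sum]
  refine Finset.sum_le_sum fun i hi => ?_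
  rw [Finset.mem_Icc] at hi
  have hRi := hR.pos_of_mem hi.1 hi.2
  have := H (-(R i • k)) (neg_ne_zero.2 (smul_ne_zero hRi.ne' hk))
  rwa [norm_neg, norm_smul, Real.norm_of_nonneg hRi.le] at this

end

end FeffermanGregg

end

/-! ### Positive definiteness of the kernels -/

open FeffermanGregg in
theorem propositionA5 (d : ℕ) (ε : ℝ) (hε : 0 < ε) (hεd : ε < (d : ℝ) / 2)
    (η : ℝ) (hη : 0 < η) (hη' : η ≤ 1 / 2)
    (ρ : ℝ → ℝ) (hρ : FeffermanGregg.IsProfile η ρ) :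
    ∃ C : ℝ, 0 < C ∧
      ∀ s : ℝ, ε ≤ s → s ≤ (d : ℝ) - ε →
      ∀ M : ℕ, 1 ≤ M → ∀ R : ℕ → ℝ, FeffermanGregg.IsScales d M R →
        FeffermanGregg.IsPositiveDefinite (fun x : FeffermanGregg.E d =>
          C / M * ‖x‖ ^ (-s)
            + 1 / M * ∑ i ∈ Finset.Icc 1 M, FeffermanGregg.errRiesz d η ρ s (R i) x) ∧
        FeffermanGregg.IsPositiveDefinite (fun x : FeffermanGregg.E d =>
          C / M * ‖x‖ ^ (-s)
            - 1 / M * ∑ i ∈ Finset.Icc 1 M, FeffermanGregg.errRiesz d η ρ s (R i) x) ∧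
        FeffermanGregg.IsPositiveDefinite (fun x : FeffermanGregg.E d =>
          1 / M * ∑ i ∈ Finset.Icc 1 M, FeffermanGregg.avgRiesz d η ρ s (R i) x) ∧
        ∀ i : ℕ, 1 ≤ i → i ≤ M →
          FeffermanGregg.IsPositiveDefinite (fun x : FeffermanGregg.E d =>
            C / ‖x‖ ^ s + FeffermanGregg.Q d η ρ (R i) x / ‖x‖ ^ s) ∧
          FeffermanGregg.IsPositiveDefinite (fun x : FeffermanGregg.E d =>
            C / ‖x‖ ^ s - FeffermanGregg.Q d η ρ (R i) x / ‖x‖ ^ s) := by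
  have hd : 1 ≤ d := by
    rcases Nat.eq_zero_or_pos d with rfl | h
    · norm_num at hεd
      linarith
    · exact h
  have : Nonempty (Fin d) := ⟨⟨0, hd⟩⟩
  have hne : ∀ᵐ k : E d, k ≠ 0 := by simp [MeasureTheory.ae_iff]
  obtain ⟨C, hC, H⟩ := exists_multiplier_bound hd hε hη hη' hρ
  set e := min ε (1 / 2) with he
  have he0 : 0 < e := lt_min hε (by norm_num)
  have hg := Real.one_lt_rpow (one_lt_growth hd) he0
  set K := 2 * ((1 + 4 * √(d : ℝ) * volB d 1) ^ e /
        ((1 + 4 * √(d : ℝ) * volB d 1) ^ e - 1)) with hKdef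
  have hK : 0 < K := mul_pos two_pos (div_pos (by linarith) (by linarith))
  -- The error sum needs `C * K` and the single-scale kernels need `C`; `C * (1 + K)` exceeds both.
  refine ⟨C * (1 + K), by positivity, fun s hs hs' M hM R hR => ?_⟩
  have hs0 : 0 < s := hε.trans_le hs
  have hsd : s < d := by linarith
  -- The range `[ε, d - ε]` is invariant under `s ↦ d - s`.
  have Hs := H (d - s) (by linarith) (by linarith)
  have hc := rieszConst_pos hs0 hsd
  have hM0 : (0 : ℝ) < M := by exact_mod_cast hM
  have hpos : ∀ k : E d, 0 ≤ rieszConst d s * ‖k‖ ^ (-(d - s)) := fun k => by positivity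
  have hRpos : ∀ i ∈ Finset.Icc 1 M, 0 < R i := fun i hi =>
    hR.pos_of_mem (Finset.mem_Icc.1 hi).1 (Finset.mem_Icc.1 hi).2
  have hsumS := HasSymbol.sum (Finset.Icc 1 M) fun i hi =>
    hasSymbol_errRiesz hd hη hη' hρ hs0 hsd (hRpos i hi)
  have hsum_eq : ∀ k : E d, k ≠ 0 → ∑ i ∈ Finset.Icc 1 M, (rieszConst d s * ‖k‖ ^ (-(d - s))
      - rieszConst d s * (R i ^ (d - s) * potential d η ρ (d - s) (-(R i • k)))
      - rieszConst d s * (‖k‖ ^ (-(d - s)) *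
        (Q₀Fourier d η ρ (-(R i • k)) / ∫ x, Q₀ d η ρ x)))
      = rieszConst d s * ‖k‖ ^ (-(d - s)) *
        ∑ i ∈ Finset.Icc 1 M, errRatio d η ρ (d - s) (-(R i • k)) := by
    intro k hk
    rw [Finset.mul_sum]
    exact Finset.sum_congr rfl fun i hi => errSymbol_eq (hRpos i hi) hk
  have hbound : ∀ k : E d, k ≠ 0 →
      |∑ i ∈ Finset.Icc 1 M, errRatio d η ρ (d - s) (-(R i • k))| ≤ C * (1 + K) := by
    intro k hk
    refine (abs_sum_errRatio_le hd hC.le he0 (fun k hk => (Hs k hk).2) hM hR hk).trans ?_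
    rw [← hKdef]
    nlinarith
  have hriesz := hasSymbol_riesz hd hs0 hsd
  refine ⟨?_, ?_, ?_, fun i hi hiM => ⟨?_, ?_⟩⟩
  · refine ((hriesz.const_mul (C * (1 + K) / M)).add
      (hsumS.const_mul (1 / M))).isPositiveDefinite ?_
    filter_upwards [hne] with k hk
    rw [hsum_eq k hk]
    have h1 := (abs_le.1 (hbound k hk)).1
    calc 0 ≤ 1 / (M : ℝ) * (rieszConst d s * ‖k‖ ^ (-(d - s)) * (C * (1 + K)
          + ∑ i ∈ Finset.Icc 1 M, errRatio d η ρ (d - s) (-(R i • k)))) :=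
          mul_nonneg (by positivity) (mul_nonneg (hpos k) (by linarith))
      _ = _ := by ring
  · refine ((hriesz.const_mul (C * (1 + K) / M)).sub
      (hsumS.const_mul (1 / M))).isPositiveDefinite ?_
    filter_upwards [hne] with k hk
    rw [hsum_eq k hk]
    have h1 := (abs_le.1 (hbound k hk)).2
    calc 0 ≤ 1 / (M : ℝ) * (rieszConst d s * ‖k‖ ^ (-(d - s)) * (C * (1 + K)
          - ∑ i ∈ Finset.Icc 1 M, errRatio d η ρ (d - s) (-(R i • k)))) :=
          mul_nonneg (by positivity) (mul_nonneg (hpos k) (by linarith))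
      _ = _ := by ring
  · refine ((HasSymbol.sum (Finset.Icc 1 M) fun i hi =>
      hasSymbol_avgRiesz hd hη hη' hρ hs0 hsd (hRpos i hi)).const_mul
      (1 / M)).isPositiveDefinite (Filter.Eventually.of_forall fun k => ?_)
    refine mul_nonneg (by positivity) (Finset.sum_nonneg fun i _ => ?_)
    exact mul_nonneg hc.le (mul_nonneg (by positivity)
      (div_nonneg (Q₀Fourier_nonneg hη' hρ _) (integral_Q₀_pos hη hη' hρ).le))
  all_goals
    have hRi := hR.pos_of_mem hi hiM
    have hQ := hasSymbol_Q_riesz hd hη hη' hρ hs0 hsd hRi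
    have hsym : (fun x : E d => C * (1 + K) / ‖x‖ ^ s)
        = fun x => C * (1 + K) * ‖x‖ ^ (-s) := by
      ext x
      rw [Real.rpow_neg (norm_nonneg _), div_eq_mul_inv]
    have hC' := hriesz.const_mul (C * (1 + K))
    rw [← hsym] at hC'
  -- With the plus sign both symbols are nonnegative; the minus sign below uses that the potential
  -- symbol is at most `C` times the Riesz symbol.
  · refine (hC'.add hQ).isPositiveDefinite (Filter.Eventually.of_forall fun k => ?_)
    have := hpos k
    have := potential_nonneg hη' hρ (d - s) (-(R i • k))
    positivity
  · refine (hC'.sub hQ).isPositiveDefinite ?_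
    filter_upwards [hne] with k hk
    have h1 := (Hs (-(R i • k)) (neg_ne_zero.2 (smul_ne_zero hRi.ne' hk))).1
    rw [rpow_scale hRi hk]
    have h2 : C ≤ C * (1 + K) := by nlinarith
    calc 0 ≤ rieszConst d s * ‖k‖ ^ (-(d - s)) * (C * (1 + K)
          - ‖-(R i • k)‖ ^ (d - s) * potential d η ρ (d - s) (-(R i • k))) :=
          mul_nonneg (hpos k) (by linarith)
      _ = _ := by ring
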